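/- \textbf{Setting.} Let $N$ be a Poisson process with rate $\lambda>0$ on a probability space $(\Omega,\mathcal A,\mathbb P)$, let $U_1,U_2,\dots$ be non-negative i.i.d. random variables independent of $N$, and put $S(t)=\sum_{n=1}^{N(t)}U_n$. Let $c_1,c_2>0$, $b_1,b_2>0$ with $b_1+b_2=1$, and $q>0$. For $\mathbf x=(x_1,x_2)\in\mathbb R^2$ let $X_i(t)=x_i+c_it-b_iS(t)$, $i=1,2$, and let $\mathbb F$ be the natural filtration of $\mathbf X=(X_1,X_2)$. The solvency set is $\mathcal S=\mathbb R^2\setminus(-\infty,0)^2$. For a process $\mathbf L=(L_1,L_2)$ put $\mathbf X^{\mathbf L}=\mathbf X-\mathbf L$ and $\tau^{\mathbf L}=\inf\{t>0: X_1^{\mathbf L}(t)<0\text{ and }X_2^{\mathbf L}(t)<0\}$, where $\inf\emptyset=\infty$. For $\mathbf x\in\mathcal S$ let $\Pi_{\mathbf x}$ be the set of admissible dividend strategies, i.e. of the $\mathbb F$-predictable processes $\mathbf L$ with values in $\mathbb R^2$ such that, almost surely, for $i=1,2$: $L_i$ is non-decreasing and c\`agl\`ad with $L_i(0)=0$; for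 every $t\ge0$ with $X_i(t)<L_i(t)$, $L_i$ is constant on $[t,t+\delta]$ for some $\delta>0$; for every $t\ge 0$ with $X_i(t)\ge L_i(t)$, one has $X_i(s)\ge L_i(s)$ for all $s\in[t,t+\delta]$ for some $\delta>0$; and $L_i(t)=L_i(\tau^{\mathbf L})$ for all $t\ge\tau^{\mathbf L}$. Define $$V(\mathbf x)=\sup_{\mathbf L\in\Pi_{\mathbf x}}\mathbb E\Big[\int_0^{\tau^{\mathbf L}}e^{-qs}\,dL_1(s)+\int_0^{\tau^{\mathbf L}}e^{-qs}\,dL_2(s)\Big]\quad(\mathbf x\in\mathcal S),\qquad V(\mathbf x)=0\quad(\mathbf x\in(-\infty,0)^2),$$ where $\int_0^T$ denotes the Lebesgue--Stieltjes integral over $[0,T)$, so that a lump sum $L_i(0+)-L_i(0)$ paid at time $0$ is included and a lump sum $L_i(T+)-L_i(T)$ paid at time $T$ is not. \textbf{Proposition (Dynamic Programming Principle).} For every $\mathbf x\in\mathcal S$ and every $\mathbb F$-stopping time $\tau$ with values in $[0,\infty]$, $V(\mathbf x)$ is finite and $$V(\mathbf x)=\sup_{\mathbf L\in\Pi_{\mathbf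 x}}\mathbb E\Big[\int_0^{\tau\wedge\tau^{\mathbf L}}e^{-qs}\,dL_1(s)+\int_0^{\tau\wedge\tau^{\mathbf L}}e^{-qs}\,dL_2(s)+e^{-q(\tau\wedge\tau^{\mathbf L})}\,V\big(\mathbf X^{\mathbf L}(\tau\wedge\tau^{\mathbf L})\big)\Big],$$ where the last term is read as $0$ where $\tau\wedge\tau^{\mathbf L}=\infty$. -/

import Mathlib

open MeasureTheory ProbabilityTheory Filter Set
open scoped NNReal ENNReal Topology

noncomputable section

/-- `N` is a Poisson process with rate `rate`: a counting process (sample paths with values in `ℕ`,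
started at `0`, nondecreasing and right-continuous) whose increments are independent and
Poisson distributed with parameter `rate * (t - s)`. -/
structure IsPoissonProcess {Ω : Type*} [MeasurableSpace Ω] (N : ℝ≥0 → Ω → ℕ) (rate : ℝ≥0)
    (P : Measure Ω) : Prop where
  measurable : ∀ t, Measurable (N t)
  zero : ∀ ω, N 0 ω = 0
  mono : ∀ ω, Monotone fun t => N t ω
  rightCts : ∀ ω t, ContinuousWithinAt (fun s => N s ω) (Ici t) t
  indep : HasIndepIncrements N P
  law : ∀ s t : ℝ≥0, s ≤ t →
    P.map (fun ω => N t ω - N s ω) = poissonMeasure (rate * (t - s))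

/-- The data of the degenerate bivariate risk model (the two branches are indexed by `Fin 2`):
premium rates `c`, proportions `b`, discount rate `q`, claim arrival process `N`
with rate `rate`, and claim sizes `U n`. -/
structure DegenerateRiskModel (Ω : Type*) [MeasurableSpace Ω] (P : Measure Ω) where
  c : Fin 2 → ℝ
  b : Fin 2 → ℝ
  q : ℝ
  rate : ℝ≥0
  N : ℝ≥0 → Ω → ℕ
  U : ℕ → Ω → ℝ
  c_pos : ∀ i, 0 < c i
  b_pos : ∀ i, 0 < b i
  b_sum : b 0 + b 1 = 1
  q_pos : 0 < q
  rate_pos : 0 < rate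
  poisson : IsPoissonProcess N rate P
  U_measurable : ∀ n, Measurable (U n)
  U_nonneg : ∀ n ω, 0 ≤ U n ω
  U_indep : iIndepFun U P
  U_ident : ∀ n, IdentDistrib (U n) (U 0) P P
  U_indep_N : IndepFun (fun ω n => U n ω) (fun ω t => N t ω) P

/-- The solvency set: the plane without the open negative quadrant. -/
def solvencySet : Set (Fin 2 → ℝ) := {x | ¬ ∀ i, x i < 0}

/-- Left-continuous with (finite) right limits. -/
def IsCaglad (f : ℝ≥0 → ℝ) : Prop :=
  ∀ t, ContinuousWithinAt f (Iio t) t ∧ ∃ l, Tendsto f (𝓝[>] t) (𝓝 l)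

open Classical in
/-- The Lebesgue–Stieltjes measure `dℓ` on `ℝ` of a nondecreasing path `ℓ` on `[0, ∞)`, extended to
negative times by the constant `ℓ 0`. If `ℓ` is left-continuous, then `[a, b)` has mass
`ℓ b - ℓ a` for `0 ≤ a ≤ b`; in particular `{0}` has mass `ℓ (0+) - ℓ 0`.
(The value for a path that is not monotone is irrelevant.) -/
def pathMeasure (ℓ : ℝ≥0 → ℝ) : Measure ℝ :=
  if h : Monotone (fun s : ℝ => ℓ s.toNNReal) then h.stieltjesFunction.measure else 0

/-- `∫_{[0, T)} e^{-q s} dℓ(s)`, where `T = ⊤` stands for `T = ∞`. Since `ℓ` is left-continuous,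
`ℓ t` does not contain a lump sum paid at time `t`, and the integral up to `T` does not contain
a lump sum paid at time `T` either. -/
def discountedIntegral (q : ℝ) (ℓ : ℝ≥0 → ℝ) (T : WithTop ℝ≥0) : ℝ≥0∞ :=
  ∫⁻ s in {s : ℝ | 0 ≤ s ∧ (s.toNNReal : WithTop ℝ≥0) < T},
    ENNReal.ofReal (Real.exp (-q * s)) ∂(pathMeasure ℓ)

namespace DegenerateRiskModel

variable {Ω : Type*} [MeasurableSpace Ω] {P : Measure Ω}

/-- The aggregate claim process `S(t) = ∑_{n ≤ N(t)} U_n`. -/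
def claims (M : DegenerateRiskModel Ω P) (t : ℝ≥0) (ω : Ω) : ℝ :=
  ∑ n ∈ Finset.range (M.N t ω), M.U n ω

/-- The uncontrolled surplus `X(t) = x + c t - b S(t)` started at `x`. -/
def surplus (M : DegenerateRiskModel Ω P) (x : Fin 2 → ℝ) (t : ℝ≥0) (ω : Ω) : Fin 2 → ℝ :=
  fun i => x i + M.c i * t - M.b i * M.claims t ω

theorem measurable_claims (M : DegenerateRiskModel Ω P) (t : ℝ≥0) : Measurable (M.claims t) := by
  have h : Measurable (fun p : ℕ × Ω => ∑ n ∈ Finset.range p.1, M.U n p.2) :=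
    measurable_from_prod_countable_right fun k =>
      Finset.measurable_sum (Finset.range k) fun n _ => M.U_measurable n
  exact h.comp ((M.poisson.measurable t).prodMk measurable_id)

theorem measurable_surplus (M : DegenerateRiskModel Ω P) (x : Fin 2 → ℝ) (t : ℝ≥0) :
    Measurable (M.surplus x t) :=
  measurable_pi_lambda _ fun _ => ((M.measurable_claims t).const_mul _).const_sub _

/-- The natural filtration of the uncontrolled surplus process. -/
def filtration (M : DegenerateRiskModel Ω P) (x : Fin 2 → ℝ) :
    Filtration ℝ≥0 (inferInstance : MeasurableSpace Ω) :=
  Filtration.natural (M.surplus x) fun t => (M.measurable_surplus x t).stronglyMeasurable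

/-- The controlled surplus `X^L(t) = X(t) - L(t)`. -/
def controlled (M : DegenerateRiskModel Ω P) (x : Fin 2 → ℝ) (L : ℝ≥0 → Ω → Fin 2 → ℝ)
    (t : ℝ≥0) (ω : Ω) : Fin 2 → ℝ :=
  fun i => M.surplus x t ω i - L t ω i

/-- The time of simultaneous ruin, `inf {t > 0 : X₁^L(t) < 0 and X₂^L(t) < 0}`
(with `inf ∅ = ⊤`). -/
def ruinTime (M : DegenerateRiskModel Ω P) (x : Fin 2 → ℝ) (L : ℝ≥0 → Ω → Fin 2 → ℝ)
    (ω : Ω) : WithTop ℝ≥0 :=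
  sInf ((fun t : ℝ≥0 => (t : WithTop ℝ≥0)) '' {t | 0 < t ∧ ∀ i, M.controlled x L t ω i < 0})

/-- Admissible dividend strategies for the initial surplus `x`. As usual, the conditions on the
sample paths are required almost surely. -/
structure IsAdmissible (M : DegenerateRiskModel Ω P) (x : Fin 2 → ℝ)
    (L : ℝ≥0 → Ω → Fin 2 → ℝ) : Prop where
  predictable : IsStronglyPredictable (M.filtration x) L
  mono : ∀ᵐ ω ∂P, ∀ i, Monotone fun t => L t ω i
  caglad : ∀ᵐ ω ∂P, ∀ i, IsCaglad fun t => L t ω i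
  zero : ∀ᵐ ω ∂P, ∀ i, L 0 ω i = 0
  /-- If `X_i(t) < L_i(t)`, then `dL_i(t) = 0`: nothing is paid at, and right after, time `t`. -/
  no_pay : ∀ᵐ ω ∂P, ∀ i t, M.surplus x t ω i < L t ω i → ∀ᶠ s in 𝓝[>] t, L s ω i = L t ω i
  /-- If `X_i(t) ≥ L_i(t)`, then `X_i^L(t) + dX_i(t) ≥ dL_i(t)`: the payments at, and right after,
  time `t` do not make the controlled surplus of the branch negative. -/
  no_ruin_by_pay : ∀ᵐ ω ∂P, ∀ i t, L t ω i ≤ M.surplus x t ω i →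
    ∀ᶠ s in 𝓝[>] t, L s ω i ≤ M.surplus x s ω i
  /-- No dividends are paid from the ruin time on. -/
  stopped : ∀ᵐ ω ∂P, ∀ i (r t : ℝ≥0), M.ruinTime x L ω = r → r ≤ t → L t ω i = L r ω i

/-- The discounted dividends of both branches paid before time `T`,
`∫_0^T e^{-q s} dL₁(s) + ∫_0^T e^{-q s} dL₂(s)`. -/
def dividends (M : DegenerateRiskModel Ω P) (L : ℝ≥0 → Ω → Fin 2 → ℝ) (T : WithTop ℝ≥0)
    (ω : Ω) : ℝ≥0∞ :=
  ∑ i, discountedIntegral M.q (fun t => L t ω i) T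

/-- The value `V^L(x)` of a strategy: its expected discounted dividends up to ruin. -/
def strategyValue (M : DegenerateRiskModel Ω P) (x : Fin 2 → ℝ) (L : ℝ≥0 → Ω → Fin 2 → ℝ) :
    ℝ≥0∞ :=
  ∫⁻ ω, M.dividends L (M.ruinTime x L ω) ω ∂P

open Classical in
/-- The optimal value function `V`: the supremum of `V^L(x)` over all admissible `L` if `x` is in
the solvency set, and zero on the open negative quadrant. -/
def value (M : DegenerateRiskModel Ω P) (x : Fin 2 → ℝ) : ℝ≥0∞ :=
  if x ∈ solvencySet then ⨆ (L) (_ : M.IsAdmissible x L), M.strategyValue x L else 0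

open Classical in
/-- `e^{-q T} V(X^L(T))`, which is zero for `T = ∞`. -/
def discountedValue (M : DegenerateRiskModel Ω P) (x : Fin 2 → ℝ) (L : ℝ≥0 → Ω → Fin 2 → ℝ)
    (T : WithTop ℝ≥0) (ω : Ω) : ℝ≥0∞ :=
  if T = ⊤ then 0
  else ENNReal.ofReal (Real.exp (-M.q * (T.untopD 0 : ℝ≥0))) *
    M.value (M.controlled x L (T.untopD 0) ω)

end DegenerateRiskModel

end

/-!
Along a fixed path of the claim process, admissibility of a dividend payment is a deterministic
condition that involves countably many times only, and a predictable strategy coincides almost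
surely with a nonanticipating rule applied to the claim path. Integration by parts turns discounted
dividends into the mean of the dividend path at an exponential time; as this time has no memory, the
payoff of a strategy that switches from one rule to another at time `τ` splits into the payoffs of
the two rules. By the strong Markov property, the claims after `τ < ∞` are independent of the past
and have the original law.

For `≤`, the continuation of a rule after `τ` is admissible for the surplus reached at `τ`, so that
it is worth at most the value there. For `≥`, follow a given rule until `τ` and then a nearly
optimal rule for the lower left corner of the grid cell that contains the surplus. There are only
countably many cells, so the choice is measurable. If the cells are as large as the premiums of a
time span `δ`, then with probability at least `e^{-λδ}` there is no claim during `δ` and the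
premiums lift the corner above the whole cell: the value at the corner is at least `e^{-(q+λ)δ}`
times the value anywhere in the cell.
-/

noncomputable section

theorem continuous_induction {α : Type*} [ConditionallyCompleteLinearOrderBot α]
    [TopologicalSpace α] [OrderTopology α] [NoMaxOrder α] {p : α → Prop} (bot : p ⊥)
    (right : ∀ t, p t → ∀ᶠ u in 𝓝[>] t, p u) (left : ∀ t, ⊥ < t → (∀ u < t, p u) → p t)
    (t : α) : p t := by
  by_contra hn
  have hne : {t | ¬ p t}.Nonempty := ⟨t, hn⟩
  set t₀ := sInf {t | ¬ p t}
  have before : ∀ u < t₀, p u := fun u hu =>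
    not_not.1 (notMem_of_lt_csInf hu (OrderBot.bddBelow _))
  have at_t₀ : p t₀ := by
    rcases eq_bot_or_bot_lt t₀ with h | h
    · exact h ▸ bot
    · exact left _ h before
  obtain ⟨v, hv, after⟩ := mem_nhdsGT_iff_exists_Ioo_subset.1 (right _ at_t₀)
  obtain ⟨u, hu, huv⟩ := exists_lt_of_csInf_lt hne hv
  rcases (csInf_le (OrderBot.bddBelow _) hu).eq_or_lt with h | h
  · exact hu (h ▸ at_t₀)
  · exact hu (after ⟨h, huv⟩)

/-- A sequence of times that is dense in `[0, ∞)`; measurability is reduced to these times. -/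
def denseTime : ℕ → ℝ≥0 := TopologicalSpace.denseSeq ℝ≥0

theorem exists_denseTime_between {a b : ℝ≥0} (h : a < b) :
    ∃ n, a < denseTime n ∧ denseTime n < b := by
  obtain ⟨z, ⟨n, rfl⟩, hz⟩ := (TopologicalSpace.denseRange_denseSeq ℝ≥0).exists_between h
  exact ⟨n, hz⟩

theorem exists_denseTime_of_eventually_nhdsGT {p : ℝ≥0 → Prop} {t : ℝ≥0}
    (h : ∀ᶠ u in 𝓝[>] t, p u) : ∃ n, t < denseTime n ∧ p (denseTime n) := by
  obtain ⟨v, hv, hp⟩ := mem_nhdsGT_iff_exists_Ioo_subset.1 h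
  obtain ⟨n, hn⟩ := exists_denseTime_between hv
  exact ⟨n, hn.1, hp hn⟩

/-- Nondecreasing right-continuous step paths started at `0`: the possible sample paths of the
aggregate claim process. Being a right-continuous step path is encoded by `right'`, as a monotone
path that returns to its value at `t` at a later time is constant in between. -/
structure StepPath where
  /-- The underlying function. -/
  toFun : ℝ≥0 → ℝ
  mono' : Monotone toFun
  zero' : toFun 0 = 0
  right' : ∀ t, ∃ v > t, toFun v = toFun t

namespace StepPath

instance : CoeFun StepPath fun _ => ℝ≥0 → ℝ := ⟨toFun⟩

instance : MeasurableSpace StepPath := MeasurableSpace.comap toFun inferInstance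

theorem mono (s : StepPath) : Monotone s := s.mono'

@[simp] theorem zero (s : StepPath) : s 0 = 0 := s.zero'

theorem nonneg (s : StepPath) (t : ℝ≥0) : 0 ≤ s t := by
  simpa using s.mono zero_le

theorem exists_const (s : StepPath) (t : ℝ≥0) :
    ∃ v > t, ∀ u, t ≤ u → u ≤ v → s u = s t := by
  obtain ⟨v, hv, h⟩ := s.right' t
  exact ⟨v, hv, fun u h1 h2 => le_antisymm (h ▸ s.mono h2) (s.mono h1)⟩

theorem eventually_eq (s : StepPath) (t : ℝ≥0) : ∀ᶠ u in 𝓝[>] t, s u = s t := by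
  obtain ⟨v, hv, hconst⟩ := s.exists_const t
  filter_upwards [Ioo_mem_nhdsGT hv] with u hu using hconst u hu.1.le hu.2.le

theorem exists_first_time_eq (s : StepPath) (t : ℝ≥0) :
    ∃ u ≤ t, s u = s t ∧ ∀ w < u, s w < s t := by
  set u := sInf {u | s u = s t}
  have hut : u ≤ t := csInf_le (OrderBot.bddBelow _) rfl
  refine ⟨u, hut, ?_, fun w hw => (s.mono (hw.le.trans hut)).lt_of_ne
    fun h => notMem_of_lt_csInf hw (OrderBot.bddBelow _) h⟩
  obtain ⟨v, hv, hconst⟩ := s.exists_const u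
  obtain ⟨w, hw, hwv⟩ := exists_lt_of_csInf_lt (s := {u | s u = s t}) ⟨t, rfl⟩ hv
  exact (hconst w (csInf_le (OrderBot.bddBelow _) hw) hwv.le).symm.trans hw

@[ext] theorem ext {s s' : StepPath} (h : ∀ t, s t = s' t) : s = s' := by
  cases s; cases s'; congr; exact funext h

theorem measurable_toFun : Measurable toFun := comap_measurable _

theorem measurable_apply (t : ℝ≥0) : Measurable fun s : StepPath => s t :=
  (measurable_pi_apply t).comp measurable_toFun

theorem measurable_of_apply {α : Type*} {_ : MeasurableSpace α} {f : α → StepPath}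
    (h : ∀ t, Measurable fun a => f a t) : Measurable f :=
  measurable_comap_iff.2 (measurable_pi_iff.2 h)

theorem le_iff_exists_denseTime (s : StepPath) (t : ℝ≥0) (a : ℝ) :
    s t ≤ a ↔ ∃ n, t < denseTime n ∧ s (denseTime n) ≤ a := by
  refine ⟨fun h => ?_, fun ⟨n, hn, h⟩ => (s.mono hn.le).trans h⟩
  exact exists_denseTime_of_eventually_nhdsGT ((s.eventually_eq t).mono fun u hu => hu.trans_le h)

theorem measurable_eval : Measurable fun p : ℝ≥0 × StepPath => p.2 p.1 := by
  refine measurable_of_Iic fun a => ?_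
  have countable_union : (fun p : ℝ≥0 × StepPath => p.2 p.1) ⁻¹' Iic a =
      ⋃ n, {p | p.1 < denseTime n ∧ p.2 (denseTime n) ≤ a} := by
    ext p
    simpa only [mem_preimage, mem_Iic, mem_iUnion, mem_ofPred_eq] using
      p.2.le_iff_exists_denseTime p.1 a
  rw [countable_union]
  exact MeasurableSet.iUnion fun n =>
    (measurableSet_lt measurable_fst measurable_const).inter
      (measurableSet_le ((measurable_apply _).comp measurable_snd) measurable_const)

theorem measurable_eval_comp {α : Type*} {_ : MeasurableSpace α} {f : α → StepPath} {T : α → ℝ≥0}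
    (hf : Measurable f) (hT : Measurable T) : Measurable fun a => f a (T a) :=
  measurable_eval.comp (hT.prodMk hf)

/-- The path stopped at time `T`. -/
def stopAt (s : StepPath) (T : ℝ≥0) : StepPath :=
  ⟨fun u => s (min u T), fun u v h => s.mono (min_le_min_right _ h), by simp, fun t => by
    obtain ⟨v, hv, h⟩ := s.exists_const t
    refine ⟨v, hv, ?_⟩
    rcases le_total t T with h1 | h1
    · rw [min_eq_left h1]
      exact h _ (le_min hv.le h1) (min_le_left _ _)
    · rw [min_eq_right h1, min_eq_right (h1.trans hv.le)]⟩

@[simp] theorem stopAt_apply (s : StepPath) (T u : ℝ≥0) : s.stopAt T u = s (min u T) := rfl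

theorem measurable_stopAt {α : Type*} {_ : MeasurableSpace α} {f : α → StepPath} {T : α → ℝ≥0}
    (hf : Measurable f) (hT : Measurable T) : Measurable fun a => (f a).stopAt (T a) :=
  measurable_of_apply fun t =>
    measurable_eval_comp (T := fun a => min t (T a)) hf (measurable_const.min hT)

/-- The increments of the path after time `T`. -/
def shift (s : StepPath) (T : ℝ≥0) : StepPath :=
  ⟨fun u => s (T + u) - s T, fun u v h => sub_le_sub_right (s.mono (by gcongr)) _, by simp,
    fun t => by
      obtain ⟨v, hv, h⟩ := s.exists_const (T + t)
      have hTv : T ≤ v := le_self_add.trans hv.le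
      refine ⟨v - T, lt_tsub_iff_left.2 hv, ?_⟩
      rw [add_tsub_cancel_of_le hTv, h v hv.le le_rfl]⟩

@[simp] theorem shift_apply (s : StepPath) (T u : ℝ≥0) : s.shift T u = s (T + u) - s T := rfl

theorem measurable_shift {α : Type*} {_ : MeasurableSpace α} {f : α → StepPath} {T : α → ℝ≥0}
    (hf : Measurable f) (hT : Measurable T) : Measurable fun a => (f a).shift (T a) :=
  measurable_of_apply fun t =>
    (measurable_eval_comp hf (hT.add_const t)).sub (measurable_eval_comp hf hT)

/-- The path that follows `s` up to time `T` and has the increments of `s'` afterwards. -/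
def concat (T : ℝ≥0) (s s' : StepPath) : StepPath :=
  ⟨fun u => s (min u T) + s' (u - T), fun u v h =>
    add_le_add (s.mono (min_le_min_right _ h)) (s'.mono (tsub_le_tsub_right h _)), by simp,
    fun t => by
      obtain ⟨v, hv, h⟩ := s.exists_const t
      obtain ⟨v', hv', h'⟩ := s'.exists_const (t - T)
      rcases lt_or_ge t T with h1 | h1
      · refine ⟨min v T, lt_min hv h1, ?_⟩
        rw [tsub_eq_zero_of_le (min_le_right v T), tsub_eq_zero_of_le h1.le, min_eq_left h1.le,
          min_eq_left (min_le_right v T), h _ (le_min hv.le h1.le) (min_le_left _ _)]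
      · have h2 : t < v' + T := by
          have := add_lt_add_of_lt_of_le hv' (le_refl T)
          rwa [tsub_add_cancel_of_le h1] at this
        refine ⟨v' + T, h2, ?_⟩
        rw [min_eq_right h1, min_eq_right (h1.trans h2.le), add_tsub_cancel_right,
          h' v' hv'.le le_rfl]⟩

theorem concat_apply (T : ℝ≥0) (s s' : StepPath) (u : ℝ≥0) :
    concat T s s' u = s (min u T) + s' (u - T) := rfl

theorem concat_of_le {T : ℝ≥0} (s s' : StepPath) {u : ℝ≥0} (h : u ≤ T) :
    concat T s s' u = s u := by
  rw [concat_apply, min_eq_left h, tsub_eq_zero_of_le h, zero, add_zero]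

theorem concat_add (T : ℝ≥0) (s s' : StepPath) (u : ℝ≥0) :
    concat T s s' (T + u) = s T + s' u := by
  rw [concat_apply, min_eq_right le_self_add, add_tsub_cancel_left]

theorem concat_stopAt_shift (s : StepPath) (T : ℝ≥0) : concat T (s.stopAt T) (s.shift T) = s := by
  ext u
  rcases le_total u T with h | h
  · rw [concat_of_le _ _ h, stopAt_apply, min_eq_left h]
  · obtain ⟨v, rfl⟩ := exists_add_of_le h
    rw [concat_add, stopAt_apply, min_self, shift_apply, add_sub_cancel]

theorem shift_concat (T : ℝ≥0) (s s' : StepPath) : (concat T s s').shift T = s' := by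
  ext u
  rw [shift_apply, concat_add, concat_of_le _ _ le_rfl, add_sub_cancel_left]

theorem measurable_concat {α : Type*} {_ : MeasurableSpace α} {f g : α → StepPath} {T : α → ℝ≥0}
    (hT : Measurable T) (hf : Measurable f) (hg : Measurable g) :
    Measurable fun a => concat (T a) (f a) (g a) :=
  measurable_of_apply fun _ =>
    (measurable_eval_comp hf (measurable_const.min hT)).add
      (measurable_eval_comp hg (measurable_const.sub hT))

theorem measure_ext_of_map_toFun {μ ν : Measure StepPath}
    (h : μ.map toFun = ν.map toFun) : μ = ν := by
  ext B ⟨B', hB', rfl⟩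
  rw [← Measure.map_apply measurable_toFun hB', h, Measure.map_apply measurable_toFun hB']

end StepPath

/-- Nondecreasing left-continuous paths started at `0`: the accumulated dividends of one branch.
Left-continuity is stated order-theoretically: a bound valid before `t` is valid at `t`. -/
structure IsDividendPath (f : ℝ≥0 → ℝ) : Prop where
  mono : Monotone f
  zero : f 0 = 0
  left : ∀ t a, 0 < t → (∀ u < t, f u ≤ a) → f t ≤ a

namespace IsDividendPath

variable {f g : ℝ≥0 → ℝ}

theorem nonneg (hf : IsDividendPath f) (t : ℝ≥0) : 0 ≤ f t := hf.zero ▸ hf.mono zero_le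

theorem of_leftContinuous (mono : Monotone f) (zero : f 0 = 0)
    (left : ∀ t, ContinuousWithinAt f (Iio t) t) : IsDividendPath f := by
  refine ⟨mono, zero, fun t a ht ha => ?_⟩
  have : (𝓝[<] t).NeBot := nhdsLT_neBot_of_exists_lt ⟨0, ht⟩
  exact le_of_tendsto (left t) (eventually_mem_nhdsWithin.mono fun u hu => ha u hu)

theorem exists_lt_of_lt (hf : IsDividendPath f) {t : ℝ≥0} {a : ℝ} (ht : 0 < t) (ha : a < f t) :
    ∃ u < t, a < f u := by
  by_contra! h
  exact (hf.left t a ht h).not_gt ha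

theorem isCaglad (hf : IsDividendPath f) : IsCaglad f := by
  refine fun t => ⟨?_, _, hf.mono.tendsto_rightLim t⟩
  rcases eq_zero_or_pos t with rfl | ht
  · have : Iio (0 : ℝ≥0) = ∅ := Iio_bot
    rw [ContinuousWithinAt, this, nhdsWithin_empty]
    exact tendsto_bot
  · refine tendsto_order.2 ⟨fun a ha => ?_, fun a ha => ?_⟩
    · obtain ⟨u, hu, hau⟩ := hf.exists_lt_of_lt ht ha
      filter_upwards [Ioo_mem_nhdsLT hu] with v hv using hau.trans_le (hf.mono hv.1.le)
    · filter_upwards [self_mem_nhdsWithin] with v hv using (hf.mono (le_of_lt hv)).trans_lt ha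

theorem lt_iff_exists_denseTime (hf : IsDividendPath f) {t : ℝ≥0} {a : ℝ} (ha : 0 ≤ a) :
    a < f t ↔ ∃ n, denseTime n < t ∧ a < f (denseTime n) := by
  refine ⟨fun h => ?_, fun ⟨n, hn, h⟩ => h.trans_le (hf.mono hn.le)⟩
  have ht : 0 < t := pos_of_ne_zero fun h0 => (h.trans_eq (h0 ▸ hf.zero)).not_ge ha
  obtain ⟨u, hu, hau⟩ := hf.exists_lt_of_lt ht h
  obtain ⟨n, hun, hnt⟩ := exists_denseTime_between hu
  exact ⟨n, hnt, hau.trans_le (hf.mono hun.le)⟩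

theorem le_of_forall_denseTime (hf : IsDividendPath f) {u t : ℝ≥0} {a : ℝ} (hut : u < t)
    (h : ∀ n, u < denseTime n → denseTime n < t → f (denseTime n) ≤ a) : f t ≤ a := by
  refine hf.left t a (zero_le.trans_lt hut) fun v hv => ?_
  obtain ⟨n, hn, hnt⟩ := exists_denseTime_between (max_lt hut hv)
  exact (hf.mono ((le_max_right _ _).trans hn.le)).trans
    (h n ((le_max_left _ _).trans_lt hn) hnt)

theorem const_zero : IsDividendPath fun _ => 0 :=
  ⟨monotone_const, rfl, fun _ _ ht h => h 0 ht⟩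

theorem shift (hf : IsDividendPath f) (T : ℝ≥0) : IsDividendPath fun t => f (T + t) - f T := by
  refine ⟨fun u v h => sub_le_sub_right (hf.mono (by gcongr)) _, by simp, fun t a ht h => ?_⟩
  rw [sub_le_iff_le_add]
  refine hf.left _ _ (ht.trans_le le_add_self) fun u hu => ?_
  rcases le_total u T with huT | hTu
  · have ha : 0 ≤ a := by simpa using h 0 ht
    exact (hf.mono huT).trans (le_add_of_nonneg_left ha)
  · obtain ⟨v, rfl⟩ := exists_add_of_le hTu
    exact sub_le_iff_le_add.1 (h v (by simpa using hu))

theorem paste (hf : IsDividendPath f) (hg : IsDividendPath g) (T : ℝ≥0) :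
    IsDividendPath fun t => f (min t T) + g (t - T) := by
  refine ⟨fun u v h => add_le_add (hf.mono (min_le_min_right _ h))
    (hg.mono (tsub_le_tsub_right h _)), by simp [hf.zero, hg.zero], fun t a ht h => ?_⟩
  rcases le_or_gt t T with h1 | h1
  · rw [min_eq_left h1, tsub_eq_zero_of_le h1, hg.zero, add_zero]
    refine hf.left _ _ ht fun u hu => ?_
    simpa [min_eq_left (hu.le.trans h1), tsub_eq_zero_of_le (hu.le.trans h1), hg.zero]
      using h u hu
  · rw [min_eq_right h1.le, ← le_sub_iff_add_le']
    refine hg.left _ _ (tsub_pos_of_lt h1) fun u hu => ?_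
    have := h (u + T) (lt_tsub_iff_right.1 hu)
    rw [min_eq_right le_add_self, add_tsub_cancel_right] at this
    linarith

end IsDividendPath

/-- Nonanticipating measurable payment rules: the amounts paid before time `t` are a function of the
claims before time `t`. Predictable strategies are represented by such rules. -/
structure PathStrategy where
  /-- The accumulated payments along a given claim path. -/
  toFun : StepPath → ℝ≥0 → Fin 2 → ℝ
  measurable' : ∀ t, Measurable fun s => toFun s t
  nonanticipating : ∀ s s' t, (∀ u < t, s.toFun u = s'.toFun u) → toFun s t = toFun s' t
  isDividendPath : ∀ s i, IsDividendPath fun t => toFun s t i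

namespace PathStrategy

instance : CoeFun PathStrategy fun _ => StepPath → ℝ≥0 → Fin 2 → ℝ := ⟨toFun⟩

theorem measurable_apply (F : PathStrategy) (t : ℝ≥0) (i : Fin 2) :
    Measurable fun s => F s t i := (measurable_pi_apply i).comp (F.measurable' t)

theorem measurable_eval (F : PathStrategy) (i : Fin 2) :
    Measurable fun p : ℝ≥0 × StepPath => F p.2 p.1 i := by
  refine measurable_of_Ioi fun a => ?_
  rcases lt_or_ge a 0 with ha | ha
  · convert MeasurableSet.univ
    ext p
    simpa using ha.trans_le ((F.isDividendPath p.2 i).nonneg p.1)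
  · have countable_union : (fun p : ℝ≥0 × StepPath => F p.2 p.1 i) ⁻¹' Ioi a =
        ⋃ n, {p : ℝ≥0 × StepPath | denseTime n < p.1 ∧ a < F p.2 (denseTime n) i} := by
      ext p
      simp only [mem_preimage, mem_Ioi, mem_iUnion, mem_ofPred_eq]
      exact (F.isDividendPath p.2 i).lt_iff_exists_denseTime ha
    rw [countable_union]
    exact MeasurableSet.iUnion fun n =>
      (measurableSet_lt measurable_const measurable_fst).inter
        (measurableSet_lt measurable_const ((F.measurable_apply _ i).comp measurable_snd))

theorem measurable_eval_comp (F : PathStrategy) {α : Type*} {_ : MeasurableSpace α}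
    {f : α → StepPath} {T : α → ℝ≥0} (hf : Measurable f) (hT : Measurable T) (i : Fin 2) :
    Measurable fun a => F (f a) (T a) i :=
  (F.measurable_eval i).comp (hT.prodMk hf)

/-- Never paying anything. -/
protected def zero : PathStrategy where
  toFun _ _ _ := 0
  measurable' _ := measurable_const
  nonanticipating _ _ _ _ := rfl
  isDividendPath _ _ := .const_zero

/-- The payments after time `T`, as a function of the claims after time `T`, if the claims up to
time `T` are those of the path `y`. -/
def continuation (F : PathStrategy) (T : ℝ≥0) (y : StepPath) : PathStrategy where
  toFun s t i := F (.concat T y s) (T + t) i - F (.concat T y s) T i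
  measurable' t := measurable_pi_iff.2 fun i => by
    have concat_measurable : Measurable fun s => StepPath.concat T y s :=
      StepPath.measurable_concat measurable_const measurable_const measurable_id
    exact ((F.measurable_apply _ i).comp concat_measurable).sub
      ((F.measurable_apply _ i).comp concat_measurable)
  nonanticipating s s' t h := by
    have after : F (.concat T y s) (T + t) = F (.concat T y s') (T + t) := by
      refine F.nonanticipating _ _ _ fun u hu => ?_
      rcases le_total u T with huT | hTu
      · simp only [StepPath.concat_of_le _ _ huT]
      · obtain ⟨v, rfl⟩ := exists_add_of_le hTu
        rw [StepPath.concat_add, StepPath.concat_add, h v (by simpa using hu)]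
    have before : F (.concat T y s) T = F (.concat T y s') T :=
      F.nonanticipating _ _ _ fun u hu => by simp only [StepPath.concat_of_le _ _ hu.le]
    rw [after, before]
  isDividendPath s i := (F.isDividendPath _ i).shift T

theorem eq_of_le (F : PathStrategy) {s s' : StepPath} {T r : ℝ≥0} (h : ∀ u ≤ T, s u = s' u)
    (hr : r ≤ T) : F s r = F s' r :=
  F.nonanticipating _ _ _ fun u hu => h u (hu.le.trans hr)

variable {α : Type*} [MeasurableSpace α]

/-- The rules `G a` depend measurably on the parameter `a`, jointly with the claims and the time. -/
def IsMeasurableFamily (G : α → PathStrategy) : Prop :=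
  ∀ i, Measurable fun p : α × ℝ≥0 × StepPath => G p.1 p.2.2 p.2.1 i

namespace IsMeasurableFamily

variable {G G' : α → PathStrategy}

theorem measurable_eval_comp (hG : IsMeasurableFamily G) {β : Type*} {_ : MeasurableSpace β}
    {a : β → α} {s : β → StepPath} {t : β → ℝ≥0} (ha : Measurable a) (hs : Measurable s)
    (ht : Measurable t) (i : Fin 2) :
    Measurable fun b => G (a b) (s b) (t b) i :=
  (hG i).comp (ha.prodMk (ht.prodMk hs))

theorem const (F : PathStrategy) : IsMeasurableFamily fun _ : α => F :=
  fun i => (F.measurable_eval i).comp measurable_snd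

theorem of_countable [Countable α] [MeasurableSingletonClass α] (G : α → PathStrategy) :
    IsMeasurableFamily G :=
  fun i => measurable_from_prod_countable_right fun a => (G a).measurable_eval i

theorem comp (hG : IsMeasurableFamily G) {β : Type*} [MeasurableSpace β] {a : β → α}
    (ha : Measurable a) :
    IsMeasurableFamily fun b => G (a b) :=
  fun i => hG.measurable_eval_comp (ha.comp measurable_fst) (by fun_prop) (by fun_prop) i

theorem ite {A : Set α} [DecidablePred (· ∈ A)] (hA : MeasurableSet A)
    (hG : IsMeasurableFamily G) (hG' : IsMeasurableFamily G') :
    IsMeasurableFamily fun a => if a ∈ A then G a else G' a := fun i => by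
  convert Measurable.ite (measurable_fst hA) (hG i) (hG' i) using 2 with p
  exact apply_ite (fun F : PathStrategy => F p.2.2 p.2.1 i) _ _ _

theorem continuation (F : PathStrategy) :
    IsMeasurableFamily fun p : ℝ≥0 × StepPath => F.continuation p.1 p.2 := fun i => by
  have concat_measurable : Measurable fun p : (ℝ≥0 × StepPath) × ℝ≥0 × StepPath =>
      StepPath.concat p.1.1 p.1.2 p.2.2 :=
    StepPath.measurable_concat (by fun_prop) (by fun_prop) (by fun_prop)
  exact (F.measurable_eval_comp concat_measurable (by fun_prop) i).sub
    (F.measurable_eval_comp concat_measurable (by fun_prop) i)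

end IsMeasurableFamily

end PathStrategy

namespace DegenerateRiskModel

variable {Ω : Type*} [MeasurableSpace Ω] {P : Measure Ω} (M : DegenerateRiskModel Ω P)

/-- The uncontrolled surplus along a claim path. -/
def pathSurplus (x : Fin 2 → ℝ) (s : StepPath) (t : ℝ≥0) (i : Fin 2) : ℝ :=
  x i + M.c i * t - M.b i * s t

/-- Between two claims, branch `i` pays only out of a nonnegative controlled surplus. This is the
integrated form of the two local payment rules of an admissible strategy. -/
def PaysFromSurplus (x : Fin 2 → ℝ) (s : StepPath) (f : ℝ≥0 → Fin 2 → ℝ) (i : Fin 2) : Prop :=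
  ∀ u t, u ≤ t → s u = s t → f t i ≤ max (f u i) (M.pathSurplus x s t i)

/-- The conditions that admissibility imposes on the payments `f` along a single claim path:
payments are made out of a nonnegative surplus only and cease at ruin. -/
structure PathAdmissible (x : Fin 2 → ℝ) (s : StepPath) (f : ℝ≥0 → Fin 2 → ℝ) : Prop where
  pay : ∀ i, M.PaysFromSurplus x s f i
  stopped : ∀ r t, r ≤ t → (∀ i, M.pathSurplus x s r i < f r i) → ∀ i, f t i = f r i

/-- The time of simultaneous ruin along a claim path. -/
def pathRuinTime (x : Fin 2 → ℝ) (s : StepPath) (f : ℝ≥0 → Fin 2 → ℝ) : WithTop ℝ≥0 :=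
  sInf ((fun t : ℝ≥0 => (t : WithTop ℝ≥0)) '' {t | 0 < t ∧ ∀ i, M.pathSurplus x s t i - f t i < 0})

/-- Ruin has not occurred up to and including time `T`. -/
def Alive (x : Fin 2 → ℝ) (s : StepPath) (f : ℝ≥0 → Fin 2 → ℝ) (T : ℝ≥0) : Prop :=
  ∀ r ≤ T, ∃ i, f r i ≤ M.pathSurplus x s r i

variable {M} {x : Fin 2 → ℝ} {s : StepPath} {f g : ℝ≥0 → Fin 2 → ℝ} {i : Fin 2}

theorem pathSurplus_mono_time {u t : ℝ≥0} (h : u ≤ t) (hs : s u = s t) (i : Fin 2) :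
    M.pathSurplus x s u i ≤ M.pathSurplus x s t i := by
  have hc := (M.c_pos i).le
  rw [pathSurplus, pathSurplus, hs]
  gcongr

theorem pathSurplus_le (t : ℝ≥0) (i : Fin 2) : M.pathSurplus x s t i ≤ x i + M.c i * t :=
  sub_le_self _ (mul_nonneg (M.b_pos i).le (s.nonneg t))

theorem pathSurplus_congr {s s' : StepPath} {t : ℝ≥0} (h : s t = s' t) (i : Fin 2) :
    M.pathSurplus x s t i = M.pathSurplus x s' t i := by
  rw [pathSurplus, pathSurplus, h]

theorem alive_congr (F : PathStrategy) {s s' : StepPath} {T : ℝ≥0} (h : ∀ u ≤ T, s u = s' u) :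
    M.Alive x s (F s) T ↔ M.Alive x s' (F s') T :=
  forall₂_congr fun r hr => by simp only [F.eq_of_le h hr, pathSurplus_congr (h r hr)]

theorem pathSurplus_zero (x : Fin 2 → ℝ) (s : StepPath) : M.pathSurplus x s 0 = x := by
  ext i
  simp only [pathSurplus, StepPath.zero, NNReal.coe_zero, mul_zero, add_zero, sub_zero]

theorem pathSurplus_shift (x : Fin 2 → ℝ) (s : StepPath) (y : Fin 2 → ℝ) (T t : ℝ≥0) (i : Fin 2) :
    M.pathSurplus (fun i => M.pathSurplus x s T i - y i) (s.shift T) t i =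
      M.pathSurplus x s (T + t) i - y i := by
  simp only [pathSurplus, StepPath.shift_apply, NNReal.coe_add]
  ring

theorem eventually_pathSurplus_lt {t : ℝ≥0} {a : ℝ} (h : M.pathSurplus x s t i < a) :
    ∀ᶠ u in 𝓝[>] t, M.pathSurplus x s u i < a := by
  have hcont : ContinuousAt (fun u : ℝ≥0 => x i + M.c i * (u : ℝ) - M.b i * s t) t := by fun_prop
  filter_upwards [s.eventually_eq t, (hcont.eventually_lt_const h).filter_mono nhdsWithin_le_nhds]
    with u hconst hlt
  rwa [pathSurplus, hconst]

namespace PaysFromSurplus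

theorem eventually_eq (h : M.PaysFromSurplus x s f i) (hf : Monotone fun t => f t i) {t : ℝ≥0}
    (hneg : M.pathSurplus x s t i < f t i) : ∀ᶠ u in 𝓝[>] t, f u i = f t i := by
  filter_upwards [self_mem_nhdsWithin, s.eventually_eq t, eventually_pathSurplus_lt hneg]
    with u (htu : t < u) hconst hlt
  refine le_antisymm ?_ (hf htu.le)
  exact (h t u htu.le hconst.symm).trans (max_le le_rfl hlt.le)

theorem eventually_le (h : M.PaysFromSurplus x s f i) {t : ℝ≥0}
    (hle : f t i ≤ M.pathSurplus x s t i) : ∀ᶠ u in 𝓝[>] t, f u i ≤ M.pathSurplus x s u i := by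
  filter_upwards [self_mem_nhdsWithin, s.eventually_eq t] with u (htu : t < u) hconst
  exact (h t u htu.le hconst.symm).trans
    (max_le (hle.trans (pathSurplus_mono_time htu.le hconst.symm i)) le_rfl)

theorem of_eventually (hf : IsDividendPath fun t => f t i)
    (no_pay : ∀ t, M.pathSurplus x s t i < f t i → ∀ᶠ u in 𝓝[>] t, f u i = f t i)
    (no_ruin : ∀ t, f t i ≤ M.pathSurplus x s t i →
      ∀ᶠ u in 𝓝[>] t, f u i ≤ M.pathSurplus x s u i) :
    M.PaysFromSurplus x s f i := by
  intro u
  refine continuous_induction (fun h0 _ => ?_) (fun v hv => ?_) (fun v hv0 hv _ hsv => ?_)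
  · rw [le_antisymm h0 zero_le]
    exact le_max_left _ _
  · rcases lt_or_ge v u with hvu | huv
    · filter_upwards [Ioo_mem_nhdsGT hvu] with w hw huw using absurd huw hw.2.not_ge
    rcases lt_or_ge (M.pathSurplus x s v i) (f v i) with hneg | hle
    · filter_upwards [no_pay v hneg, s.eventually_eq v] with w hfw hconst _ hsw
      have := hv huv (hsw.trans hconst)
      rw [hfw]
      exact ((le_max_iff.1 this).resolve_right hneg.not_ge).trans (le_max_left _ _)
    · filter_upwards [no_ruin v hle] with w hw _ _ using hw.trans (le_max_right _ _)
  · refine hf.left v _ hv0 fun w hwv => ?_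
    rcases le_total w u with hwu | huw
    · exact (hf.mono hwu).trans (le_max_left _ _)
    · have hsw : s u = s w := le_antisymm (s.mono huw) (hsv ▸ s.mono hwv.le)
      exact (hv w hwv huw hsw).trans
        (max_le_max le_rfl (pathSurplus_mono_time hwv.le (hsw ▸ hsv) i))

theorem le_affine (h : M.PaysFromSurplus x s f i) (hf : IsDividendPath fun t => f t i) (t : ℝ≥0) :
    f t i ≤ max (x i) 0 + M.c i * t := by
  have hc := (M.c_pos i).le
  refine continuous_induction (p := fun t => f t i ≤ max (x i) 0 + M.c i * t) ?_
    (fun v hv => ?_) (fun v hv0 hv => ?_) t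
  · simp [hf.zero]
  · filter_upwards [self_mem_nhdsWithin, s.eventually_eq v] with u (hvu : v < u) hconst
    refine (h v u hvu.le hconst.symm).trans (max_le (hv.trans (by gcongr)) ?_)
    exact (pathSurplus_le u i).trans (by gcongr; exact le_max_left _ _)
  · exact hf.left v _ hv0 fun u hu => (hv u hu).trans (by gcongr)

/-- By left-continuity, `f u` at the last claim time `u` before `t` is the supremum of the payments
at the times before that claim, which are recognized by `s (denseTime m) < s t`. -/
theorem le_or_exists_denseTime (h : M.PaysFromSurplus x s f i)
    (hf : IsDividendPath fun t => f t i) (t : ℝ≥0) {ε : ℝ} (hε : 0 < ε) :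
    f t i ≤ max (M.pathSurplus x s t i) 0 ∨
      ∃ m, s (denseTime m) < s t ∧ f t i ≤ f (denseTime m) i + ε := by
  obtain ⟨u, hut, hsu, hlt⟩ := s.exists_first_time_eq t
  rcases le_or_gt (f t i) (max (M.pathSurplus x s t i) 0) with hle | hgt
  · exact .inl hle
  obtain ⟨hsurplus, hpos⟩ := max_lt_iff.1 hgt
  have hfu : f t i ≤ f u i := (le_max_iff.1 (h u t hut hsu)).resolve_right hsurplus.not_ge
  obtain ⟨m, hmu, hm⟩ := (hf.lt_iff_exists_denseTime (le_max_right (f t i - ε) 0)).1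
    (show _ < f u i from max_lt (by linarith) (by linarith))
  exact .inr ⟨m, hlt _ hmu, by linarith [le_max_left (f t i - ε) 0]⟩

theorem of_denseTime (hf : IsDividendPath fun t => f t i)
    (h : ∀ n (k : ℕ), f (denseTime n) i ≤ max (M.pathSurplus x s (denseTime n) i) 0 ∨
      ∃ m, s (denseTime m) < s (denseTime n) ∧
        f (denseTime n) i ≤ f (denseTime m) i + 1 / ((k : ℝ) + 1)) :
    M.PaysFromSurplus x s f i := by
  intro u t hut hs
  rcases hut.eq_or_lt with rfl | hut
  · exact le_max_left _ _
  refine hf.le_of_forall_denseTime hut fun n hun hnt => ?_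
  have hsn : s (denseTime n) = s t := le_antisymm (s.mono hnt.le) (hs ▸ s.mono hun.le)
  by_cases hle : f (denseTime n) i ≤ max (M.pathSurplus x s (denseTime n) i) 0
  · refine hle.trans (max_le ?_ ((hf.nonneg u).trans (le_max_left _ _)))
    exact (pathSurplus_mono_time hnt.le hsn i).trans (le_max_right _ _)
  refine le_trans (le_of_forall_pos_le_add fun ε hε => ?_) (le_max_left _ _)
  obtain ⟨k, hk⟩ := exists_nat_one_div_lt hε
  obtain ⟨m, hsm, hm⟩ := (h n k).resolve_left hle
  have hmu : denseTime m ≤ u := by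
    by_contra! hum
    exact (s.mono hum.le).not_gt (hs ▸ hsn ▸ hsm)
  exact hm.trans (add_le_add (hf.mono hmu) hk.le)

end PaysFromSurplus

theorem pathRuinTime_le {t : ℝ≥0} (ht : 0 < t) (hneg : ∀ i, M.pathSurplus x s t i < f t i) :
    M.pathRuinTime x s f ≤ t :=
  csInf_le (OrderBot.bddBelow _) ⟨t, ⟨ht, fun i => sub_neg.2 (hneg i)⟩, rfl⟩

theorem exists_ruin_of_pathRuinTime_lt {v : ℝ≥0} (h : M.pathRuinTime x s f < v) :
    ∃ t < v, 0 < t ∧ ∀ i, M.pathSurplus x s t i < f t i := by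
  have hne : ((fun t : ℝ≥0 => (t : WithTop ℝ≥0)) ''
      {t | 0 < t ∧ ∀ i, M.pathSurplus x s t i - f t i < 0}).Nonempty := by
    by_contra hempty
    rw [pathRuinTime, not_nonempty_iff_eq_empty.1 hempty, WithTop.sInf_empty] at h
    exact not_top_lt h
  obtain ⟨_, ⟨t, ⟨ht, hneg⟩, rfl⟩, htv⟩ := exists_lt_of_csInf_lt hne h
  exact ⟨t, WithTop.coe_lt_coe.1 htv, ht, fun i => sub_neg.1 (hneg i)⟩

theorem pos_of_ruined (hx : x ∈ solvencySet) (hf0 : ∀ i, f 0 i = 0) {r : ℝ≥0}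
    (hneg : ∀ i, M.pathSurplus x s r i < f r i) : 0 < r := by
  refine pos_of_ne_zero ?_
  rintro rfl
  exact hx fun i => by simpa only [pathSurplus_zero, hf0] using hneg i

namespace PathAdmissible

theorem of_eventually (hx : x ∈ solvencySet) (hf : ∀ i, IsDividendPath fun t => f t i)
    (no_pay : ∀ i t, M.pathSurplus x s t i < f t i → ∀ᶠ u in 𝓝[>] t, f u i = f t i)
    (no_ruin : ∀ i t, f t i ≤ M.pathSurplus x s t i →
      ∀ᶠ u in 𝓝[>] t, f u i ≤ M.pathSurplus x s u i)
    (stopped : ∀ i (r t : ℝ≥0), M.pathRuinTime x s f = r → r ≤ t → f t i = f r i) :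
    M.PathAdmissible x s f := by
  refine ⟨fun i => .of_eventually (hf i) (no_pay i) (no_ruin i), fun r t hrt hneg i => ?_⟩
  have hle : M.pathRuinTime x s f ≤ r :=
    pathRuinTime_le (pos_of_ruined hx (fun i => (hf i).zero) hneg) hneg
  obtain ⟨ρ, hρ⟩ := WithTop.ne_top_iff_exists.1 (hle.trans_lt (WithTop.coe_lt_top r)).ne
  rw [← hρ, WithTop.coe_le_coe] at hle
  rw [stopped i ρ t hρ.symm (hle.trans hrt), stopped i ρ r hρ.symm hle]

theorem neg_at_ruin (h : M.PathAdmissible x s f) {r : ℝ≥0} (hr : M.pathRuinTime x s f = r)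
    (i : Fin 2) : M.pathSurplus x s r i < f r i := by
  by_contra! hle
  obtain ⟨v, hrv, hsolvent⟩ := mem_nhdsGT_iff_exists_Ioo_subset.1 ((h.pay i).eventually_le hle)
  have hlt : M.pathRuinTime x s f < v := by rw [hr]; exact WithTop.coe_lt_coe.2 hrv
  obtain ⟨t, htv, ht, hneg⟩ := exists_ruin_of_pathRuinTime_lt hlt
  have hrt : r ≤ t := WithTop.coe_le_coe.1 (hr ▸ pathRuinTime_le ht hneg)
  rcases hrt.eq_or_lt with rfl | hrt
  · exact (hneg i).not_ge hle
  · exact (hneg i).not_ge (hsolvent ⟨hrt, htv⟩)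

theorem stopped_at_ruin (h : M.PathAdmissible x s f) (i : Fin 2) (r t : ℝ≥0)
    (hr : M.pathRuinTime x s f = r) (hrt : r ≤ t) : f t i = f r i :=
  h.stopped r t hrt (h.neg_at_ruin hr) i

theorem of_denseTime (hf : ∀ i, IsDividendPath fun t => f t i)
    (pay : ∀ i, M.PaysFromSurplus x s f i)
    (stopped : ∀ n m, denseTime n ≤ denseTime m →
      (∀ i, M.pathSurplus x s (denseTime n) i < f (denseTime n) i) →
      ∀ i, f (denseTime m) i = f (denseTime n) i) :
    M.PathAdmissible x s f := by
  refine ⟨pay, fun r t hrt hneg i => ?_⟩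
  rcases hrt.eq_or_lt with rfl | hrt
  · rfl
  have still_ruined : ∀ᶠ u in 𝓝[>] r,
      u < t ∧ ∀ i, M.pathSurplus x s u i < f r i ∧ f u i = f r i := by
    filter_upwards [Ioo_mem_nhdsGT hrt, eventually_all.2 fun i =>
      (eventually_pathSurplus_lt (hneg i)).and ((pay i).eventually_eq (hf i).mono (hneg i))]
      with u hu h using ⟨hu.2, h⟩
  obtain ⟨n, -, hnt, hn⟩ := exists_denseTime_of_eventually_nhdsGT still_ruined
  refine le_antisymm ?_ ((hf i).mono hrt.le)
  refine (hf i).le_of_forall_denseTime hnt fun m hnm _ => ?_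
  rw [stopped n m hnm.le (fun j => (hn j).2 ▸ (hn j).1) i, (hn i).2]

theorem iff_denseTime (hf : ∀ i, IsDividendPath fun t => f t i) :
    M.PathAdmissible x s f ↔
      (∀ i n (k : ℕ), f (denseTime n) i ≤ max (M.pathSurplus x s (denseTime n) i) 0 ∨
        ∃ m, s (denseTime m) < s (denseTime n) ∧
          f (denseTime n) i ≤ f (denseTime m) i + 1 / ((k : ℝ) + 1)) ∧
      (∀ n m, denseTime n ≤ denseTime m →
        (∀ i, M.pathSurplus x s (denseTime n) i < f (denseTime n) i) →
        ∀ i, f (denseTime m) i = f (denseTime n) i) :=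
  ⟨fun h => ⟨fun i _ _ => (h.pay i).le_or_exists_denseTime (hf i) _ Nat.one_div_pos_of_nat,
    fun _ _ => h.stopped _ _⟩,
  fun ⟨pay, stopped⟩ => .of_denseTime hf (fun i => .of_denseTime (hf i) (pay i)) stopped⟩

theorem alive_iff_denseTime (h : M.PathAdmissible x s f) (T : ℝ≥0) :
    M.Alive x s f T ↔ (∃ i, f T i ≤ M.pathSurplus x s T i) ∧
      ∀ n, denseTime n < T → ∃ i, f (denseTime n) i ≤ M.pathSurplus x s (denseTime n) i := by
  refine ⟨fun hA => ⟨hA T le_rfl, fun n hn => hA _ hn.le⟩, fun ⟨hT, hdense⟩ r hr => ?_⟩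
  rcases hr.eq_or_lt with rfl | hr
  · exact hT
  by_contra! hneg
  have still_ruined : ∀ᶠ u in 𝓝[>] r, u < T ∧ ∀ i, M.pathSurplus x s u i < f r i := by
    filter_upwards [Ioo_mem_nhdsGT hr, eventually_all.2 fun i => eventually_pathSurplus_lt (hneg i)]
      with u hu h using ⟨hu.2, h⟩
  obtain ⟨n, hrn, hnT, hn⟩ := exists_denseTime_of_eventually_nhdsGT still_ruined
  obtain ⟨i, hi⟩ := hdense n hnT
  exact (hn i).not_ge (h.stopped r _ hrn.le hneg i ▸ hi)

theorem lt_pathRuinTime_iff (h : M.PathAdmissible x s f) (hx : x ∈ solvencySet)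
    (hf0 : ∀ i, f 0 i = 0) (T : ℝ≥0) :
    (T : WithTop ℝ≥0) < M.pathRuinTime x s f ↔ M.Alive x s f T := by
  refine ⟨fun hT r hr => ?_, fun hA => ?_⟩
  · by_contra! hneg
    have := hT.trans_le (pathRuinTime_le (pos_of_ruined hx hf0 hneg) hneg)
    exact (WithTop.coe_lt_coe.1 this).not_ge hr
  · by_contra! hle
    obtain ⟨r, hr⟩ := WithTop.ne_top_iff_exists.1 (hle.trans_lt (WithTop.coe_lt_top T)).ne
    obtain ⟨i, hi⟩ := hA r (WithTop.coe_le_coe.1 (hr ▸ hle))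
    exact (h.neg_at_ruin hr.symm i).not_ge hi

protected theorem zero (x : Fin 2 → ℝ) (s : StepPath) : M.PathAdmissible x s (fun _ _ => 0) :=
  ⟨fun _ _ _ _ _ => le_max_left _ _, fun _ _ _ _ _ => rfl⟩

theorem mono (h : M.PathAdmissible x s f) {y : Fin 2 → ℝ} (hxy : x ≤ y) :
    M.PathAdmissible y s f := by
  have surplus_le : ∀ t i, M.pathSurplus x s t i ≤ M.pathSurplus y s t i := fun t i => by
    unfold pathSurplus
    gcongr
    exact hxy i
  exact ⟨fun i u t hut hs => (h.pay i u t hut hs).trans (max_le_max le_rfl (surplus_le t i)),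
    fun r t hrt hneg => h.stopped r t hrt fun i => (surplus_le r i).trans_lt (hneg i)⟩

theorem shift (h : M.PathAdmissible x s f) (T : ℝ≥0) :
    M.PathAdmissible (fun i => M.pathSurplus x s T i - f T i) (s.shift T)
      (fun t i => f (T + t) i - f T i) := by
  refine ⟨fun i u t hut hs => ?_, fun r t hrt hneg i => ?_⟩
  · rw [pathSurplus_shift, max_sub_sub_right]
    refine sub_le_sub_right (h.pay i _ _ (by gcongr) ?_) _
    simpa using hs
  · rw [h.stopped (T + r) (T + t) (by gcongr) fun i => ?_]
    exact (sub_lt_sub_iff_right _).1 (pathSurplus_shift (M := M) x s (f T) T r i ▸ hneg i)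

end PathAdmissible

theorem PaysFromSurplus.paste (h : M.PaysFromSurplus x s f i) (hg0 : g 0 i = 0) {T : ℝ≥0}
    (h' : M.PaysFromSurplus (fun i => M.pathSurplus x s T i - f T i) (s.shift T) g i) :
    M.PaysFromSurplus x s (fun t i => f (min t T) i + g (t - T) i) i := by
  intro u t hut hs
  rcases le_total t T with htT | hTt
  · simp only [min_eq_left htT, min_eq_left (hut.trans htT), tsub_eq_zero_of_le htT,
      tsub_eq_zero_of_le (hut.trans htT), hg0, add_zero]
    exact h u t hut hs
  obtain ⟨t, rfl⟩ := exists_add_of_le hTt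
  simp only [min_eq_right hTt, add_tsub_cancel_left]
  have surplus_after_T := pathSurplus_shift (M := M) x s (f T) T t i
  rcases le_total u T with huT | hTu
  · simp only [min_eq_left huT, tsub_eq_zero_of_le huT, hg0, add_zero]
    have hsT : s T = s (T + t) := le_antisymm (s.mono hTt) (hs ▸ s.mono huT)
    have until_T := h u T huT (hs.trans hsT.symm)
    have after_T := h' 0 t zero_le (by simp [hsT])
    have surplus_mono := pathSurplus_mono_time (M := M) (x := x) hTt hsT i
    rw [hg0] at after_T
    grind
  · obtain ⟨u, rfl⟩ := exists_add_of_le hTu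
    simp only [min_eq_right hTu, add_tsub_cancel_left]
    have after_T := h' u t (by simpa using hut) (by simpa using hs)
    grind

namespace PathAdmissible

theorem paste (h : M.PathAdmissible x s f) (hg0 : ∀ i, g 0 i = 0) {T : ℝ≥0}
    (h' : M.PathAdmissible (fun i => M.pathSurplus x s T i - f T i) (s.shift T) g)
    (hA : M.Alive x s f T) :
    M.PathAdmissible x s (fun t i => f (min t T) i + g (t - T) i) := by
  refine ⟨fun i => (h.pay i).paste (hg0 i) (h'.pay i), fun r t hrt hneg i => ?_⟩
  have hTr : T ≤ r := by
    by_contra! hrT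
    obtain ⟨j, hj⟩ := hA r hrT.le
    have := hneg j
    rw [min_eq_left hrT.le, tsub_eq_zero_of_le hrT.le, hg0, add_zero] at this
    exact this.not_ge hj
  obtain ⟨t, rfl⟩ := exists_add_of_le (hTr.trans hrt)
  obtain ⟨r, rfl⟩ := exists_add_of_le hTr
  simp only [min_eq_right le_self_add, add_tsub_cancel_left] at hneg ⊢
  rw [h'.stopped r t (by simpa using hrt) fun j => ?_]
  rw [pathSurplus_shift]
  linarith [hneg j]

theorem paste_zero (h : M.PathAdmissible x s f) (T : ℝ≥0) :
    M.PathAdmissible x s (fun t i => f (min t T) i) := by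
  refine ⟨fun i u t hut hs => ?_, fun r t hrt hneg i => ?_⟩
  · rcases le_total t T with htT | hTt
    · simp only [min_eq_left htT, min_eq_left (hut.trans htT)]
      exact h.pay i u t hut hs
    rw [min_eq_right hTt]
    rcases le_total u T with huT | hTu
    · rw [min_eq_left huT]
      have hsT : s T = s t := le_antisymm (s.mono hTt) (hs ▸ s.mono huT)
      exact (h.pay i u T huT (hs.trans hsT.symm)).trans
        (max_le_max le_rfl (pathSurplus_mono_time hTt hsT i))
    · rw [min_eq_right hTu]
      exact le_max_left _ _
  · rcases le_total r T with hrT | hTr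
    · simp only [min_eq_left hrT] at hneg ⊢
      exact h.stopped _ _ (le_min hrt hrT) hneg i
    · rw [min_eq_right hTr, min_eq_right (hTr.trans hrt)]

end PathAdmissible

section measurability

variable {α : Type*} {_ : MeasurableSpace α}

theorem measurable_pathSurplus {x : α → Fin 2 → ℝ} {s : α → StepPath} {t : α → ℝ≥0}
    (hx : Measurable x) (hs : Measurable s) (ht : Measurable t) (i : Fin 2) :
    Measurable fun a => M.pathSurplus (x a) (s a) (t a) i :=
  (((measurable_pi_apply i).comp hx).add (ht.coe_nnreal_real.const_mul _)).sub
    ((StepPath.measurable_eval_comp hs ht).const_mul _)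

theorem measurableSet_pathAdmissible {x : α → Fin 2 → ℝ} {s : α → StepPath}
    {f : α → ℝ≥0 → Fin 2 → ℝ} (hx : Measurable x) (hs : Measurable s)
    (hf : ∀ t i, Measurable fun a => f a t i) (hd : ∀ a i, IsDividendPath fun t => f a t i) :
    MeasurableSet {a | M.PathAdmissible (x a) (s a) (f a)} := by
  simp only [PathAdmissible.iff_denseTime (hd _), ofPred_and, ofPred_forall]
  have surplus_measurable : ∀ t i, Measurable fun a => M.pathSurplus (x a) (s a) t i :=
    fun t => measurable_pathSurplus hx hs measurable_const
  have claims_measurable : ∀ t, Measurable fun a => s a t := fun t =>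
    (StepPath.measurable_apply t).comp hs
  refine MeasurableSet.inter ?_ ?_
  · refine .iInter fun i => .iInter fun n => .iInter fun k => ?_
    simp only [ofPred_or, ofPred_exists, ofPred_and]
    refine .union (measurableSet_le (hf _ i) ((surplus_measurable _ i).max measurable_const))
      (.iUnion fun m => ?_)
    exact .inter (measurableSet_lt (claims_measurable _) (claims_measurable _))
      (measurableSet_le (hf _ i) ((hf _ i).add_const _))
  · refine .iInter fun n => .iInter fun m => .iInter fun _ => ?_
    refine .imp ?_ ?_ <;> simp only [ofPred_forall]
    · exact .iInter fun i => measurableSet_lt (surplus_measurable _ i) (hf _ i)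
    · exact .iInter fun i => measurableSet_eq_fun (hf _ i) (hf _ i)

end measurability

end DegenerateRiskModel

instance (q : ℝ) : SFinite (expMeasure q) := by
  unfold expMeasure gammaMeasure
  infer_instance

theorem lintegral_expMeasure (q : ℝ) {φ : ℝ → ℝ≥0∞} (hφ : Measurable φ) :
    ∫⁻ u, φ u ∂expMeasure q = ∫⁻ u, exponentialPDF q u * φ u :=
  lintegral_withDensity_eq_lintegral_mul _ (measurable_gammaPDFReal 1 q).ennreal_ofReal hφ

theorem expMeasure_Ioi {q a : ℝ} (hq : 0 < q) (ha : 0 ≤ a) :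
    expMeasure q (Ioi a) = ENNReal.ofReal (Real.exp (-q * a)) := by
  have := isProbabilityMeasure_expMeasure hq
  have hexp : Real.exp (-q * a) ≤ 1 := Real.exp_le_one_iff.2 (by nlinarith)
  rw [← compl_Iic, prob_compl_eq_one_sub measurableSet_Iic, ← ofReal_cdf, cdf_expMeasure_eq hq,
    if_pos ha, ← ENNReal.ofReal_one, ← ENNReal.ofReal_sub _ (by simpa using hexp), sub_sub_cancel,
    neg_mul]

theorem lintegral_sub_expMeasure (q : ℝ) {T : ℝ} (hT : 0 ≤ T) {φ : ℝ → ℝ≥0∞} (hφ : Measurable φ)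
    (hφ0 : ∀ u ≤ 0, φ u = 0) :
    ∫⁻ u, φ (u - T) ∂expMeasure q =
      ENNReal.ofReal (Real.exp (-q * T)) * ∫⁻ u, φ u ∂expMeasure q := by
  have memoryless : ∀ u, exponentialPDF q (u + T) * φ u =
      ENNReal.ofReal (Real.exp (-q * T)) * (exponentialPDF q u * φ u) := fun u => by
    rcases le_or_gt u 0 with hu | hu
    · rw [hφ0 u hu, mul_zero, mul_zero, mul_zero]
    rw [exponentialPDF_of_nonneg hu.le, exponentialPDF_of_nonneg (by positivity), ← mul_assoc,
      ← ENNReal.ofReal_mul (Real.exp_pos _).le]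
    congr 2
    rw [show -(q * (u + T)) = -q * T + -(q * u) by ring, Real.exp_add]
    ring
  have hφT : Measurable fun u => φ (u - T) := hφ.comp (measurable_id.sub_const T)
  rw [lintegral_expMeasure q hφT, lintegral_expMeasure q hφ, ← lintegral_add_right_eq_self _ T,
    ← lintegral_const_mul' _ _ ENNReal.ofReal_ne_top]
  exact lintegral_congr fun u => by rw [add_sub_cancel_right, memoryless]

theorem lintegral_ofReal_expMeasure_lt_top {q : ℝ} (hq : 0 < q) :
    ∫⁻ u, ENNReal.ofReal u ∂expMeasure q < ∞ := by
  have tail : ∀ t ∈ Ioi (0 : ℝ),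
      expMeasure q {u | t < max u 0} = ENNReal.ofReal (Real.exp (-q * t)) := fun t ht => by
    have : {u : ℝ | t < max u 0} = Ioi t := by
      ext u
      simp [(mem_Ioi.1 ht).le]
    rw [this, expMeasure_Ioi hq (mem_Ioi.1 ht).le]
  calc ∫⁻ u, ENNReal.ofReal u ∂expMeasure q
      = ∫⁻ u, ENNReal.ofReal (max u 0) ∂expMeasure q :=
        lintegral_congr fun u => by simp [ENNReal.ofReal_max]
    _ = ∫⁻ t in Ioi (0 : ℝ), expMeasure q {u | t < max u 0} :=
        lintegral_eq_lintegral_meas_lt _ (ae_of_all _ fun u => le_max_right u 0) (by fun_prop)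
    _ = ∫⁻ t in Ioi (0 : ℝ), ENNReal.ofReal (Real.exp (-q * t)) :=
        setLIntegral_congr_fun measurableSet_Ioi tail
    _ < ∞ := (integrableOn_exp_mul_Ioi (neg_neg_of_pos hq) 0).lintegral_lt_top

/-- The discounted payments of a path `f`, as the expectation of `f` at an independent exponential
time with parameter `q`; for a left-continuous nondecreasing path started at `0` this is
`∫_{[0, ∞)} e^{-q u} df(u)`. -/
def payoff (q : ℝ) (f : ℝ≥0 → ℝ) : ℝ≥0∞ :=
  ∫⁻ u, ENNReal.ofReal (f u.toNNReal) ∂expMeasure q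

theorem leftLim_comp_toNNReal {f : ℝ≥0 → ℝ} (hf : IsDividendPath f) (a : ℝ) :
    Function.leftLim (fun s : ℝ => f s.toNNReal) a = f a.toNNReal := by
  have hm : Monotone fun s : ℝ => f s.toNNReal := fun a b h => hf.mono (Real.toNNReal_mono h)
  refine hm.continuousWithinAt_Iio_iff_leftLim_eq.1 ?_
  rcases le_or_gt a 0 with ha | ha
  · refine (continuousWithinAt_const (b := f 0)).congr (fun u hu => ?_) ?_
    · rw [Real.toNNReal_of_nonpos ((mem_Iio.1 hu).le.trans ha)]
    · rw [Real.toNNReal_of_nonpos ha]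
  · exact (hf.isCaglad a.toNNReal).1.comp (t := Iio a.toNNReal)
      continuous_real_toNNReal.continuousWithinAt fun u hu =>
        (Real.toNNReal_lt_toNNReal_iff ha).2 hu

theorem pathMeasure_Ico {f : ℝ≥0 → ℝ} (hf : IsDividendPath f) (b : ℝ) :
    pathMeasure f (Ico 0 b) = ENNReal.ofReal (f b.toNNReal) := by
  have hm : Monotone fun s : ℝ => f s.toNNReal := fun a b h => hf.mono (Real.toNNReal_mono h)
  have hleft : ∀ a : ℝ, Function.leftLim hm.stieltjesFunction a = f a.toNNReal := fun a =>
    (leftLim_rightLim (hm.tendsto_leftLim a)).trans (leftLim_comp_toNNReal hf a)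
  rw [pathMeasure, dif_pos hm, StieltjesFunction.measure_Ico, hleft, hleft, Real.toNNReal_zero,
    hf.zero, sub_zero]

instance (f : ℝ≥0 → ℝ) : SFinite (pathMeasure f) := by
  rw [pathMeasure]
  split_ifs <;> infer_instance

theorem setOf_toNNReal_lt_inter_Iio (T : WithTop ℝ≥0) {u : ℝ} (hu : 0 ≤ u) :
    {s : ℝ | 0 ≤ s ∧ (s.toNNReal : WithTop ℝ≥0) < T} ∩ Iio u =
      Ico 0 (((min (u.toNNReal : WithTop ℝ≥0) T).untopD 0 : ℝ≥0) : ℝ) := by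
  ext s
  simp only [mem_inter_iff, mem_ofPred_eq, mem_Iio, mem_Ico, and_assoc]
  refine and_congr_right fun hs => ?_
  induction T with
  | top =>
    rw [min_eq_left le_top, WithTop.untopD_coe, Real.coe_toNNReal _ hu]
    exact and_iff_right (WithTop.coe_lt_top _)
  | coe T =>
    rw [← WithTop.coe_min, WithTop.untopD_coe, WithTop.coe_lt_coe, NNReal.coe_min,
      Real.coe_toNNReal _ hu, lt_min_iff, and_comm, ← NNReal.coe_lt_coe, Real.coe_toNNReal _ hs]

/-- Integration by parts: `e^{-q s}` is the probability that an exponential time exceeds `s`, and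
Fubini's theorem exchanges it with `df`. -/
theorem discountedIntegral_eq_payoff {q : ℝ} (hq : 0 < q) {f : ℝ≥0 → ℝ} (hf : IsDividendPath f)
    (T : WithTop ℝ≥0) :
    discountedIntegral q f T = payoff q fun u => f ((min (u : WithTop ℝ≥0) T).untopD 0) := by
  set A : Set ℝ := {s : ℝ | 0 ≤ s ∧ (s.toNNReal : WithTop ℝ≥0) < T}
  have hA : MeasurableSet A := by
    have : OrdConnected A := ⟨fun a ha b hb c hc => ⟨ha.1.trans hc.1,
      (WithTop.coe_le_coe.2 (Real.toNNReal_mono hc.2)).trans_lt hb.2⟩⟩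
    exact this.measurableSet
  have hlt : MeasurableSet {p : ℝ × ℝ | p.1 < p.2} := measurableSet_lt measurable_fst measurable_snd
  calc discountedIntegral q f T
      = ∫⁻ s in A, expMeasure q (Ioi s) ∂pathMeasure f :=
        setLIntegral_congr_fun hA fun s hs => (expMeasure_Ioi hq hs.1).symm
    _ = ((pathMeasure f).restrict A).prod (expMeasure q) {p | p.1 < p.2} :=
        (Measure.prod_apply hlt).symm
    _ = ∫⁻ u, (pathMeasure f).restrict A (Iio u) ∂expMeasure q := Measure.prod_apply_symm hlt
    _ = payoff q fun u => f ((min (u : WithTop ℝ≥0) T).untopD 0) := by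
        refine lintegral_congr fun u => ?_
        rw [Measure.restrict_apply measurableSet_Iio, inter_comm]
        rcases le_or_gt u 0 with hu | hu
        · have : A ∩ Iio u = ∅ :=
            eq_empty_of_forall_notMem fun s hs => (hs.1.1.trans_lt hs.2).not_ge hu
          simp [this, Real.toNNReal_of_nonpos hu, hf.zero]
        · rw [setOf_toNNReal_lt_inter_Iio T hu.le, pathMeasure_Ico hf, Real.toNNReal_coe]

theorem payoff_zero (q : ℝ) : payoff q (fun _ => 0) = 0 := by simp [payoff]

theorem payoff_paste (q : ℝ) {f g : ℝ≥0 → ℝ} (hf : IsDividendPath f) (hg : IsDividendPath g)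
    (T : ℝ≥0) :
    payoff q (fun t => f (min t T) + g (t - T)) =
      payoff q (fun t => f (min t T)) + ENNReal.ofReal (Real.exp (-q * T)) * payoff q g := by
  have hmf : Measurable fun u : ℝ => f (min u.toNNReal T) :=
    hf.mono.measurable.comp (measurable_real_toNNReal.min measurable_const)
  have hmg : Measurable fun u : ℝ => g u.toNNReal :=
    hg.mono.measurable.comp measurable_real_toNNReal
  have hg0 : ∀ u ≤ (0 : ℝ), ENNReal.ofReal (g u.toNNReal) = 0 := fun u hu => by
    rw [Real.toNNReal_of_nonpos hu, hg.zero, ENNReal.ofReal_zero]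
  have toNNReal_sub : ∀ u : ℝ, u.toNNReal - T = (u - T).toNNReal := fun u => by
    have := T.coe_nonneg
    ext
    rw [NNReal.coe_sub_def, Real.coe_toNNReal', Real.coe_toNNReal']
    grind
  simp only [payoff, toNNReal_sub, ENNReal.ofReal_add (hf.nonneg _) (hg.nonneg _)]
  rw [lintegral_add_left hmf.ennreal_ofReal,
    lintegral_sub_expMeasure q T.coe_nonneg hmg.ennreal_ofReal hg0]

theorem payoff_mono {q : ℝ} {f g : ℝ≥0 → ℝ} (h : ∀ t, f t ≤ g t) : payoff q f ≤ payoff q g :=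
  lintegral_mono fun _ => ENNReal.ofReal_le_ofReal (h _)

theorem payoff_affine_lt_top {q : ℝ} (hq : 0 < q) (a b : ℝ) :
    payoff q (fun t => a + b * t) < ∞ := by
  have := isProbabilityMeasure_expMeasure hq
  have bound : ∀ u : ℝ, ENNReal.ofReal (a + b * u.toNNReal) ≤
      ENNReal.ofReal a + ENNReal.ofReal b * ENNReal.ofReal u := fun u => by
    refine ENNReal.ofReal_add_le.trans (add_le_add le_rfl ?_)
    rw [ENNReal.ofReal_mul' u.toNNReal.coe_nonneg, ENNReal.ofReal_coe_nnreal]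
    rfl
  refine (lintegral_mono bound).trans_lt ?_
  rw [lintegral_add_left measurable_const, lintegral_const, measure_univ, mul_one,
    lintegral_const_mul _ ENNReal.measurable_ofReal]
  exact ENNReal.add_lt_top.2 ⟨ENNReal.ofReal_lt_top,
    ENNReal.mul_lt_top ENNReal.ofReal_lt_top (lintegral_ofReal_expMeasure_lt_top hq)⟩

theorem measurable_payoff {α : Type*} {_ : MeasurableSpace α} (q : ℝ) {f : α → ℝ≥0 → ℝ}
    (hf : Measurable fun p : α × ℝ≥0 => f p.1 p.2) : Measurable fun a => payoff q (f a) := by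
  refine Measurable.lintegral_prod_right'
    (f := fun p : α × ℝ => ENNReal.ofReal (f p.1 p.2.toNNReal)) ?_
  exact (hf.comp
    (measurable_fst.prodMk (measurable_real_toNNReal.comp measurable_snd))).ennreal_ofReal

theorem isStronglyPredictable_of_isDividendPath {Ω ι : Type*} [Countable ι] {m : MeasurableSpace Ω}
    {ℱ : Filtration ℝ≥0 m} {L : ℝ≥0 → Ω → ι → ℝ}
    (hL : ∀ ω i, IsDividendPath fun t => L t ω i) (hm : ∀ t i, Measurable[ℱ t] fun ω => L t ω i) :
    IsStronglyPredictable ℱ L := by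
  suffices h : Measurable[ℱ.predictable] (Function.uncurry L) from h.stronglyMeasurable
  refine @measurable_pi_lambda _ _ _ ℱ.predictable _ _ fun i => ?_
  refine measurable_of_Ioi (mδ := ℱ.predictable) fun a => ?_
  rcases lt_or_ge a 0 with ha | ha
  · have : (fun p : ℝ≥0 × Ω => Function.uncurry L p i) ⁻¹' Ioi a = univ :=
      eq_univ_of_forall fun p => ha.trans_le ((hL p.2 i).nonneg p.1)
    rw [this]
    exact @MeasurableSet.univ _ ℱ.predictable
  · have countable_union : (fun p : ℝ≥0 × Ω => Function.uncurry L p i) ⁻¹' Ioi a =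
        ⋃ n, Ioi (denseTime n) ×ˢ {ω | a < L (denseTime n) ω i} := by
      ext p
      simp only [mem_preimage, mem_Ioi, mem_iUnion, mem_prod, mem_ofPred_eq]
      exact (hL p.2 i).lt_iff_exists_denseTime ha
    rw [countable_union]
    exact @MeasurableSet.iUnion _ _ ℱ.predictable _ _ fun n =>
      measurableSet_predictable_Ioi_prod (hm _ i measurableSet_Ioi)

namespace DegenerateRiskModel

variable {Ω : Type*} [mΩ : MeasurableSpace Ω] {P : Measure Ω} (M : DegenerateRiskModel Ω P)

/-- The aggregate claims as a random step path. -/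
def claimPath (ω : Ω) : StepPath where
  toFun t := M.claims t ω
  mono' u v h := Finset.sum_le_sum_of_subset_of_nonneg
    (Finset.range_mono (M.poisson.mono ω h)) fun n _ _ => M.U_nonneg n ω
  zero' := by simp [claims, M.poisson.zero ω]
  right' t := by
    have eventually_eq : ∀ᶠ u in 𝓝[>] t, M.N u ω = M.N t ω :=
      ((M.poisson.rightCts ω t).eventually ((isOpen_discrete {M.N t ω}).mem_nhds rfl)).filter_mono
        (nhdsWithin_mono _ Ioi_subset_Ici_self)
    obtain ⟨v, hv, htv⟩ := (eventually_eq.and self_mem_nhdsWithin).exists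
    exact ⟨v, htv, by rw [claims, claims, hv]⟩

@[simp] theorem claimPath_apply (ω : Ω) (t : ℝ≥0) : M.claimPath ω t = M.claims t ω := rfl

theorem measurable_claimPath : Measurable M.claimPath :=
  StepPath.measurable_of_apply M.measurable_claims

theorem filtration_eq_comap (x : Fin 2 → ℝ) (t : ℝ≥0) :
    (M.filtration x t : MeasurableSpace Ω) =
      MeasurableSpace.comap (fun ω => (M.claimPath ω).stopAt t) inferInstance := by
  refine le_antisymm (iSup₂_le fun u hu => measurable_iff_comap_le.1 ?_)
    (measurable_iff_comap_le.1 ?_)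
  · have surplus_eq : M.surplus x u = (fun s => M.pathSurplus x s u) ∘
        fun ω => (M.claimPath ω).stopAt t := by
      ext ω i
      simp [surplus, pathSurplus, min_eq_left hu]
    rw [surplus_eq]
    exact (measurable_pi_iff.2 (measurable_pathSurplus measurable_const measurable_id
      measurable_const)).comp (comap_measurable _)
  · refine @StepPath.measurable_of_apply _ (M.filtration x t) _ fun u => ?_
    have hX : Measurable[M.filtration x t] (M.surplus x (min u t)) :=
      measurable_iff_comap_le.2 (le_iSup₂_of_le (min u t) (min_le_right u t) le_rfl)
    have claims_eq : (fun ω => (M.claimPath ω).stopAt t u) =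
        fun ω => (x 0 + M.c 0 * (min u t : ℝ≥0) - M.surplus x (min u t) ω 0) / M.b 0 := by
      ext ω
      have := (M.b_pos 0).ne'
      simp only [StepPath.stopAt_apply, claimPath_apply, surplus]
      field_simp
      ring
    rw [claims_eq]
    exact (((measurable_pi_apply 0).comp hX).const_sub _).div_const _

theorem measurable_stopAt_claimPath (x : Fin 2 → ℝ) (t : ℝ≥0) :
    Measurable[M.filtration x t] fun ω => (M.claimPath ω).stopAt t := by
  rw [filtration_eq_comap]
  exact comap_measurable _

/-- The law of the claim path. -/
def pathLaw : Measure StepPath := P.map M.claimPath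

instance [IsProbabilityMeasure P] : IsProbabilityMeasure M.pathLaw :=
  Measure.isProbabilityMeasure_map M.measurable_claimPath.aemeasurable

/-- A rule that is admissible along almost every claim path. -/
def AdmissibleRule (x : Fin 2 → ℝ) (F : PathStrategy) : Prop :=
  ∀ᵐ s ∂M.pathLaw, M.PathAdmissible x s (F s)

/-- The discounted payments of both branches. -/
def pathPayoff (f : ℝ≥0 → Fin 2 → ℝ) : ℝ≥0∞ := ∑ i, payoff M.q fun t => f t i

/-- The expected discounted payments of a rule. -/
def ruleValue (F : PathStrategy) : ℝ≥0∞ := ∫⁻ s, M.pathPayoff (F s) ∂M.pathLaw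

variable {M} {x : Fin 2 → ℝ} {L : ℝ≥0 → Ω → Fin 2 → ℝ}

theorem measurable_pathPayoff {α : Type*} {_ : MeasurableSpace α} {f : α → ℝ≥0 → Fin 2 → ℝ}
    (hf : ∀ i, Measurable fun p : α × ℝ≥0 => f p.1 p.2 i) :
    Measurable fun a => M.pathPayoff (f a) :=
  Finset.measurable_sum _ fun i _ => measurable_payoff M.q (hf i)

theorem measurable_pathPayoff_rule (F : PathStrategy) : Measurable fun s => M.pathPayoff (F s) :=
  measurable_pathPayoff fun i => F.measurable_eval_comp measurable_fst measurable_snd i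

theorem ruleValue_eq (F : PathStrategy) :
    M.ruleValue F = ∫⁻ ω, M.pathPayoff (F (M.claimPath ω)) ∂P :=
  lintegral_map (measurable_pathPayoff_rule F) M.measurable_claimPath

theorem admissibleRule_iff {F : PathStrategy} :
    M.AdmissibleRule x F ↔ ∀ᵐ ω ∂P, M.PathAdmissible x (M.claimPath ω) (F (M.claimPath ω)) :=
  ae_map_iff M.measurable_claimPath.aemeasurable
    (measurableSet_pathAdmissible measurable_const measurable_id F.measurable_apply
      F.isDividendPath)

theorem PathAdmissible.sum_discountedIntegral {s : StepPath} {f : ℝ≥0 → Fin 2 → ℝ}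
    (h : M.PathAdmissible x s f) (hf : ∀ i, IsDividendPath fun t => f t i) (T : WithTop ℝ≥0) :
    ∑ i, discountedIntegral M.q (fun t => f t i) (min T (M.pathRuinTime x s f)) =
      M.pathPayoff fun t i => f ((min (t : WithTop ℝ≥0) T).untopD 0) i := by
  refine Finset.sum_congr rfl fun i _ => ?_
  rw [discountedIntegral_eq_payoff M.q_pos (hf i)]
  congr 1
  ext u
  obtain ⟨v, hv⟩ := WithTop.ne_top_iff_exists.1
    ((min_le_left (u : WithTop ℝ≥0) T).trans_lt (WithTop.coe_lt_top u)).ne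
  simp only [← min_assoc, ← hv, WithTop.untopD_coe]
  rcases le_total (v : WithTop ℝ≥0) (M.pathRuinTime x s f) with hv | hv
  · rw [min_eq_left hv, WithTop.untopD_coe]
  · obtain ⟨r, hr⟩ := WithTop.ne_top_iff_exists.1 (hv.trans_lt (WithTop.coe_lt_top v)).ne
    rw [min_eq_right hv, ← hr, WithTop.untopD_coe]
    rw [← hr, WithTop.coe_le_coe] at hv
    exact (h.stopped_at_ruin i r v hr.symm hv).symm

theorem dividends_ruinTime {ω : Ω} (hL : ∀ i, IsDividendPath fun t => L t ω i)
    (h : M.PathAdmissible x (M.claimPath ω) fun t => L t ω) :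
    M.dividends L (M.ruinTime x L ω) ω = M.pathPayoff fun t => L t ω := by
  have := h.sum_discountedIntegral hL ⊤
  simp only [min_eq_left le_top, WithTop.untopD_coe, min_eq_right le_top] at this
  exact this

theorem IsAdmissible.of_path (hL : ∀ ω i, IsDividendPath fun t => L t ω i)
    (hm : ∀ t i, Measurable[M.filtration x t] fun ω => L t ω i)
    (h : ∀ᵐ ω ∂P, M.PathAdmissible x (M.claimPath ω) fun t => L t ω) : M.IsAdmissible x L where
  predictable := isStronglyPredictable_of_isDividendPath hL hm
  mono := ae_of_all _ fun ω i => (hL ω i).mono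
  caglad := ae_of_all _ fun ω i => (hL ω i).isCaglad
  zero := ae_of_all _ fun ω i => (hL ω i).zero
  no_pay := h.mono fun ω hω i _ hneg => (hω.pay i).eventually_eq (hL ω i).mono hneg
  no_ruin_by_pay := h.mono fun _ hω i _ hle => (hω.pay i).eventually_le hle
  stopped := h.mono fun _ hω => hω.stopped_at_ruin

theorem IsAdmissible.ae_pathAdmissible (hx : x ∈ solvencySet) (hL : M.IsAdmissible x L) :
    ∀ᵐ ω ∂P, (∀ i, IsDividendPath fun t => L t ω i) ∧
      M.PathAdmissible x (M.claimPath ω) fun t => L t ω := by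
  filter_upwards [hL.mono, hL.caglad, hL.zero, hL.no_pay, hL.no_ruin_by_pay, hL.stopped]
    with ω mono caglad zero no_pay no_ruin stopped
  have hd : ∀ i, IsDividendPath fun t => L t ω i := fun i =>
    .of_leftContinuous (mono i) (zero i) fun t => (caglad i t).1
  exact ⟨hd, .of_eventually hx hd no_pay no_ruin stopped⟩

theorem lintegral_pathPayoff_le_value (hx : x ∈ solvencySet)
    (hL : ∀ ω i, IsDividendPath fun t => L t ω i)
    (hm : ∀ t i, Measurable[M.filtration x t] fun ω => L t ω i)
    (h : ∀ᵐ ω ∂P, M.PathAdmissible x (M.claimPath ω) fun t => L t ω) :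
    ∫⁻ ω, M.pathPayoff (fun t => L t ω) ∂P ≤ M.value x := by
  rw [← lintegral_congr_ae (h.mono fun ω hω => dividends_ruinTime (hL ω) hω), value, if_pos hx]
  exact le_iSup₂_of_le L (.of_path hL hm h) le_rfl

theorem measurable_rule_claimPath (F : PathStrategy) (x : Fin 2 → ℝ) (t : ℝ≥0) (i : Fin 2) :
    Measurable[M.filtration x t] fun ω => F (M.claimPath ω) t i := by
  have : (fun ω => F (M.claimPath ω) t i) = (fun s => F s t i) ∘
      fun ω => (M.claimPath ω).stopAt t := by
    ext ω
    rw [Function.comp_apply, F.nonanticipating _ ((M.claimPath ω).stopAt t) t fun u hu => by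
      rw [StepPath.stopAt_apply, min_eq_left hu.le]]
  rw [this]
  exact (F.measurable_apply t i).comp (M.measurable_stopAt_claimPath x t)

theorem ruleValue_le_value (hx : x ∈ solvencySet) {F : PathStrategy} (hF : M.AdmissibleRule x F) :
    M.ruleValue F ≤ M.value x := by
  rw [ruleValue_eq]
  exact lintegral_pathPayoff_le_value (L := fun t ω => F (M.claimPath ω) t) hx
    (fun ω i => F.isDividendPath _ i) (measurable_rule_claimPath F x) (admissibleRule_iff.1 hF)

end DegenerateRiskModel

/-- The left-continuous path generated by amounts `a n ≥ 0` that have been paid before the times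
`denseTime n`: it reconstructs a dividend path from its values at these times. -/
def denseSup (a : ℕ → ℝ) (t : ℝ≥0) : ℝ := ⨆ n, if denseTime n < t then a n else 0

section denseSup

variable {a : ℕ → ℝ}

theorem bddAbove_range_ite_denseTime (ha : ∀ t, BddAbove (a '' {n | denseTime n < t})) (t : ℝ≥0) :
    BddAbove (range fun n => if denseTime n < t then a n else 0) := by
  refine ((ha t).insert 0).mono ?_
  rintro _ ⟨n, rfl⟩
  dsimp only
  split_ifs with hn
  · exact .inr ⟨n, hn, rfl⟩
  · exact .inl rfl

theorem le_denseSup (ha : ∀ t, BddAbove (a '' {n | denseTime n < t})) {n : ℕ} {t : ℝ≥0}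
    (hn : denseTime n < t) : a n ≤ denseSup a t :=
  (if_pos hn).ge.trans (le_ciSup (bddAbove_range_ite_denseTime ha t) n)

theorem denseSup_le {t : ℝ≥0} {b : ℝ} (hb : 0 ≤ b) (h : ∀ n, denseTime n < t → a n ≤ b) :
    denseSup a t ≤ b := by
  refine ciSup_le fun n => ?_
  split_ifs with hn
  exacts [h n hn, hb]

theorem denseSup_nonneg (ha0 : ∀ n, 0 ≤ a n) (t : ℝ≥0) : 0 ≤ denseSup a t := by
  refine Real.iSup_nonneg fun n => ?_
  split_ifs
  exacts [ha0 n, le_rfl]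

theorem isDividendPath_denseSup (ha0 : ∀ n, 0 ≤ a n)
    (ha : ∀ t, BddAbove (a '' {n | denseTime n < t})) : IsDividendPath (denseSup a) where
  mono _ v huv := denseSup_le (denseSup_nonneg ha0 v) fun _ hn => le_denseSup ha (hn.trans_le huv)
  zero := by simp [denseSup]
  left t b ht hb := by
    refine denseSup_le ((denseSup_nonneg ha0 0).trans (hb 0 ht)) fun n hn => ?_
    obtain ⟨u, hnu, hut⟩ := exists_between hn
    exact (le_denseSup ha hnu).trans (hb u hut)

theorem denseSup_eq {f : ℝ≥0 → ℝ} (hf : IsDividendPath f) :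
    (denseSup fun n => f (denseTime n)) = f := by
  ext t
  refine le_antisymm (denseSup_le (hf.nonneg t) fun n hn => hf.mono hn.le) ?_
  rcases eq_zero_or_pos t with rfl | ht
  · rw [hf.zero]
    exact denseSup_nonneg (fun _ => hf.nonneg _) 0
  · refine hf.le_of_forall_denseTime ht fun n _ hn => ?_
    refine le_denseSup (a := fun n => f (denseTime n)) (fun t => ⟨f t, ?_⟩) hn
    rintro _ ⟨m, hm, rfl⟩
    exact hf.mono (le_of_lt hm)

end denseSup

namespace PathStrategy

theorem exists_of_denseTime {B : Fin 2 → ℝ≥0 → ℝ} (hB : ∀ i, Monotone (B i))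
    {G : ℕ → StepPath → Fin 2 → ℝ} (hG : ∀ n, Measurable (G n)) :
    ∃ F : PathStrategy, ∀ s (f : ℝ≥0 → Fin 2 → ℝ), (∀ i, IsDividendPath fun t => f t i) →
      (∀ i t, f t i ≤ B i t) → (∀ n, f (denseTime n) = G n (s.stopAt (denseTime n))) →
      F s = f := by
  -- The cutoff by `B` makes the supremum finite along the paths on which `G` is not such an `f`.
  let a (s : StepPath) (i : Fin 2) (n : ℕ) : ℝ :=
    max 0 (min (G n (s.stopAt (denseTime n)) i) (B i (denseTime n)))
  have ha : ∀ s i t, BddAbove (a s i '' {n | denseTime n < t}) := fun s i t => by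
    refine ⟨max 0 (B i t), ?_⟩
    rintro _ ⟨n, hn, rfl⟩
    exact max_le_max le_rfl ((min_le_right _ _).trans (hB i (le_of_lt hn)))
  have ha_measurable : ∀ i n, Measurable fun s => a s i n := fun i n =>
    measurable_const.max (((measurable_pi_apply i).comp ((hG n).comp
      (StepPath.measurable_stopAt measurable_id measurable_const))).min measurable_const)
  refine ⟨⟨fun s t i => denseSup (a s i) t, fun t => ?_, fun s s' t h => ?_,
    fun s i => isDividendPath_denseSup (fun _ => le_max_left _ _) (ha s i)⟩,
    fun s f hf hfB hfG => ?_⟩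
  · exact measurable_pi_lambda _ fun i => .iSup fun n =>
      .ite (.const _) (ha_measurable i n) measurable_const
  · ext i
    refine iSup_congr fun n => ite_congr rfl (fun hn => ?_) fun _ => rfl
    have : s.stopAt (denseTime n) = s'.stopAt (denseTime n) :=
      StepPath.ext fun u => h _ ((min_le_right _ _).trans_lt hn)
    simp only [a, this]
  · ext t i
    have : a s i = fun n => f (denseTime n) i := by
      ext n
      simp only [a, ← hfG n, min_eq_left (hfB i _), max_eq_right ((hf i).nonneg _)]
    exact congrFun (this ▸ denseSup_eq (hf i)) t

end PathStrategy

namespace DegenerateRiskModel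

variable {Ω : Type*} [mΩ : MeasurableSpace Ω] {P : Measure Ω} {M : DegenerateRiskModel Ω P}
  {x : Fin 2 → ℝ}

theorem IsAdmissible.exists_rule (hx : x ∈ solvencySet) {L : ℝ≥0 → Ω → Fin 2 → ℝ}
    (hL : M.IsAdmissible x L) :
    ∃ F : PathStrategy, M.AdmissibleRule x F ∧ ∀ᵐ ω ∂P, (fun t => L t ω) = F (M.claimPath ω) := by
  have adapted : ∀ n, ∃ G : StepPath → Fin 2 → ℝ, Measurable G ∧
      L (denseTime n) = G ∘ fun ω => (M.claimPath ω).stopAt (denseTime n) := fun n => by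
    have hm := (hL.predictable.stronglyAdapted (denseTime n)).measurable
    rw [filtration_eq_comap] at hm
    exact hm.exists_eq_measurable_comp
  choose G hG hGL using adapted
  have bound_mono : ∀ i, Monotone fun t : ℝ≥0 => max (x i) 0 + M.c i * t := fun i u v huv => by
    have := (M.c_pos i).le
    dsimp only
    gcongr
  obtain ⟨F, hF⟩ := PathStrategy.exists_of_denseTime bound_mono hG
  have eq_rule : ∀ᵐ ω ∂P, F (M.claimPath ω) = (fun t => L t ω) ∧
      M.PathAdmissible x (M.claimPath ω) (fun t => L t ω) := by
    filter_upwards [hL.ae_pathAdmissible hx] with ω ⟨hd, hadm⟩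
    exact ⟨hF _ _ hd (fun i => (hadm.pay i).le_affine (hd i)) fun n => congrFun (hGL n) ω, hadm⟩
  exact ⟨F, admissibleRule_iff.2 (eq_rule.mono fun ω h => h.1 ▸ h.2),
    eq_rule.mono fun _ h => h.1.symm⟩

theorem value_le {C : ℝ≥0∞} (h : ∀ F, M.AdmissibleRule x F → M.ruleValue F ≤ C) :
    M.value x ≤ C := by
  rw [value]
  split_ifs with hx
  swap
  · exact zero_le
  refine iSup₂_le fun L hL => ?_
  obtain ⟨F, hF, hLF⟩ := hL.exists_rule hx
  refine le_trans (le_of_eq ?_) (h F hF)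
  rw [ruleValue_eq]
  refine lintegral_congr_ae ?_
  filter_upwards [hLF, hL.ae_pathAdmissible hx] with ω hω ⟨hd, hadm⟩
  rw [dividends_ruinTime hd hadm, hω]

theorem value_lt_top [IsProbabilityMeasure P] (M : DegenerateRiskModel Ω P) (x : Fin 2 → ℝ) :
    M.value x < ∞ := by
  set bound : ℝ≥0 → Fin 2 → ℝ := fun t i => max (x i) 0 + M.c i * t
  have bound_finite : M.pathPayoff bound < ∞ :=
    ENNReal.sum_lt_top.2 fun i _ => payoff_affine_lt_top M.q_pos _ _
  refine (value_le fun F hF => ?_).trans_lt bound_finite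
  calc M.ruleValue F ≤ ∫⁻ _, M.pathPayoff bound ∂M.pathLaw :=
        lintegral_mono_ae <| hF.mono fun s hs => Finset.sum_le_sum fun i _ =>
          payoff_mono ((hs.pay i).le_affine (F.isDividendPath s i))
    _ = M.pathPayoff bound := by rw [lintegral_const, measure_univ, mul_one]

end DegenerateRiskModel

theorem comap_prod_eq_generateFrom {Ω α β : Type*} [MeasurableSpace α] [MeasurableSpace β]
    (f : Ω → α × β) :
    Prod.instMeasurableSpace.comap f = MeasurableSpace.generateFrom
      {s | ∃ t ∈ image2 (· ×ˢ ·) {s : Set α | MeasurableSet s} {t : Set β | MeasurableSet t},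
        f ⁻¹' t = s} := by
  rw [← generateFrom_prod, MeasurableSpace.comap_generateFrom]
  rfl

theorem indepFun_prodMk_prodMk {Ω α₁ α₂ β₁ β₂ : Type*}
    {mΩ : MeasurableSpace Ω} {P : Measure Ω} [IsZeroOrProbabilityMeasure P]
    [MeasurableSpace α₁] [MeasurableSpace α₂] [MeasurableSpace β₁] [MeasurableSpace β₂]
    {X₁ : Ω → α₁} {X₂ : Ω → α₂} {Y₁ : Ω → β₁} {Y₂ : Ω → β₂}
    (hX₁ : Measurable X₁) (hX₂ : Measurable X₂) (hY₁ : Measurable Y₁) (hY₂ : Measurable Y₂)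
    (hX : IndepFun X₁ X₂ P) (hY : IndepFun Y₁ Y₂ P)
    (h : IndepFun (fun ω => (X₁ ω, X₂ ω)) (fun ω => (Y₁ ω, Y₂ ω)) P) :
    IndepFun (fun ω => (X₁ ω, Y₁ ω)) (fun ω => (X₂ ω, Y₂ ω)) P := by
  refine IndepSets.indep (hX₁.prodMk hY₁).comap_le (hX₂.prodMk hY₂).comap_le
    (IsPiSystem.comap isPiSystem_prod _) (IsPiSystem.comap isPiSystem_prod _)
    (comap_prod_eq_generateFrom _) (comap_prod_eq_generateFrom _) ?_
  rw [IndepSets_iff]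
  rintro - - ⟨-, ⟨a, ha, b, hb, rfl⟩, rfl⟩ ⟨-, ⟨c, hc, d, hd, rfl⟩, rfl⟩
  have factor {s₁ s₂ t₁ t₂} (hs₁ : MeasurableSet s₁) (hs₂ : MeasurableSet s₂)
      (ht₁ : MeasurableSet t₁) (ht₂ : MeasurableSet t₂) :=
    indepFun_iff_measure_inter_preimage_eq_mul.1 h (s₁ ×ˢ s₂) (t₁ ×ˢ t₂) (hs₁.prod hs₂)
      (ht₁.prod ht₂)
  have factor_left := factor ha .univ hb .univ
  have factor_right := factor .univ hc .univ hd
  have factor_all := factor ha hc hb hd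
  simp only [mk_preimage_prod, preimage_univ, inter_univ, univ_inter] at *
  rw [factor_left, factor_right, inter_inter_inter_comm, factor_all,
    indepFun_iff_measure_inter_preimage_eq_mul.1 hX a c ha hc,
    indepFun_iff_measure_inter_preimage_eq_mul.1 hY b d hb hd]
  ring

theorem indepFun_initial_shift {Ω E : Type*} {mΩ : MeasurableSpace Ω} {P : Measure Ω}
    [IsZeroOrProbabilityMeasure P] [MeasurableSpace E] {X : ℕ → Ω → E} (h : iIndepFun X P)
    (hX : ∀ n, Measurable (X n)) {k l : ℕ} (hkl : k ≤ l) :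
    IndepFun (fun ω (n : Finset.range k) => X n ω) (fun ω n => X (l + n) ω) P := by
  refine IndepFun.indepFun_process (Y := fun n ω => X (l + n) ω)
    (measurable_pi_lambda _ fun n => hX n) (fun n => hX _) fun J => ?_
  have hdisj : Disjoint (Finset.range k) (J.map (addLeftEmbedding l)) := by
    rw [Finset.disjoint_left]
    intro a ha hb
    obtain ⟨n, -, rfl⟩ := Finset.mem_map.1 hb
    exact absurd (Finset.mem_range.1 ha) (not_lt.2 (hkl.trans (Nat.le_add_right _ _)))
  let reindex : (J.map (addLeftEmbedding l) → E) → J → E := fun v n =>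
    v ⟨l + n, Finset.mem_map.2 ⟨n, n.2, rfl⟩⟩
  exact (h.indepFun_finset _ _ hdisj hX).comp (φ := id) (ψ := reindex) measurable_id
    (measurable_pi_lambda _ fun n => measurable_pi_apply _)

theorem measure_inter_eq_mul_of_fibers {Ω ι : Type*} {mΩ : MeasurableSpace Ω} {P : Measure Ω}
    [Countable ι] [MeasurableSpace ι] [MeasurableSingletonClass ι] {K : Ω → ι} (hK : Measurable K)
    {A B : Set Ω} {c : ℝ≥0∞} (h : ∀ k, P (A ∩ K ⁻¹' {k} ∩ B) = P (A ∩ K ⁻¹' {k}) * c) :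
    P (A ∩ B) = P A * c := by
  have sum_fibers (G : Set Ω) : P G = ∑' k, P (G ∩ K ⁻¹' {k}) := by
    have h := tsum_measure_preimage_singleton (μ := P.restrict G) (countable_univ (α := ι))
      fun k _ => hK (measurableSet_singleton k)
    rw [preimage_univ, Measure.restrict_apply_univ,
      tsum_univ fun k => P.restrict G (K ⁻¹' {k})] at h
    simp only [← h, Measure.restrict_apply (hK (measurableSet_singleton _)), inter_comm]
  simp only [sum_fibers (A ∩ B), sum_fibers A, inter_right_comm A B, h, ENNReal.tsum_mul_right]

theorem exists_monotone_enumeration {T : Type*} [LinearOrder T] [OrderBot T] (K : Finset T) :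
    ∃ (t : ℕ → T) (m : ℕ), Monotone t ∧ t 0 = ⊥ ∧ ∀ u ∈ K, ∃ k ≤ m, t k = u := by
  induction K using Finset.induction_on_max with
  | empty => exact ⟨fun _ => ⊥, 0, monotone_const, rfl, by simp⟩
  | insert a K hK ih =>
    obtain ⟨t, m, ht, ht0, hKt⟩ := ih
    refine ⟨fun k => if k ≤ m then min (t k) a else a, m + 1, fun k l hkl => ?_, by simp [ht0],
      fun u hu => ?_⟩
    · dsimp only
      split_ifs with hk hl hl
      · exact min_le_min_right _ (ht hkl)
      · exact min_le_right _ _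
      · exact absurd (hkl.trans hl) hk
      · exact le_rfl
    · rcases Finset.mem_insert.1 hu with rfl | hu
      · exact ⟨m + 1, le_rfl, by simp⟩
      · obtain ⟨k, hk, rfl⟩ := hKt u hu
        exact ⟨k, hk.trans m.le_succ, by simp [hk, (hK _ hu).le]⟩

theorem exists_increments_determine (J : Finset ℝ≥0) :
    ∃ (t : ℕ → ℝ≥0) (m : ℕ) (φ : (Finset.range m → ℕ) → J → ℕ), Monotone t ∧ Measurable φ ∧
      ∀ n : ℝ≥0 → ℕ, Monotone n →
        φ (fun i => n (t (i + 1)) - n (t i)) = fun r : J => n r - n 0 := by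
  obtain ⟨t, m, ht, ht0, hJ⟩ := exists_monotone_enumeration J
  choose k hk htk using fun r : J => hJ r r.2
  refine ⟨t, m, fun v r => ∑ i : Finset.range (k r),
      v ⟨i, Finset.mem_range.2 ((Finset.mem_range.1 i.2).trans_le (hk r))⟩, ht,
    measurable_pi_lambda _ fun r => Finset.measurable_sum _ fun i _ => measurable_pi_apply _,
    fun n hn => funext fun r => ?_⟩
  refine (Finset.sum_coe_sort (Finset.range (k r)) fun i => n (t (i + 1)) - n (t i)).trans ?_
  rw [Finset.sum_range_tsub (f := fun i => n (t i)) (hn.comp ht), htk, ht0, bot_eq_zero]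

namespace IsPoissonProcess

variable {Ω : Type*} [MeasurableSpace Ω] {P : Measure Ω} {N : ℝ≥0 → Ω → ℕ} {rate : ℝ≥0}

theorem measurable_sub (hN : IsPoissonProcess N rate P) (s t : ℝ≥0) :
    Measurable fun ω => N t ω - N s ω := (hN.measurable t).sub (hN.measurable s)

theorem indepFun_past_future [IsProbabilityMeasure P] (hN : IsPoissonProcess N rate P) (d : ℝ≥0) :
    IndepFun (fun ω u => N (min u d) ω) (fun ω r => N (d + r) ω - N d ω) P := by
  refine IndepFun.process_indepFun_process (X := fun u ω => N (min u d) ω)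
    (Y := fun r ω => N (d + r) ω - N d ω) (fun u => hN.measurable _)
    (fun r => hN.measurable_sub _ _) fun I J => ?_
  obtain ⟨t, m, φ, ht, hφ, φ_eq⟩ := exists_increments_determine I
  obtain ⟨t', m', ψ, ht', hψ, ψ_eq⟩ := exists_increments_determine J
  -- the times for `I`, capped at `d`, followed by the times for `J`, counted from `d`
  set T : ℕ → ℝ≥0 := fun k => if k ≤ m then min (t k) d else d + t' (k - (m + 1))
  have hT : Monotone T := by
    intro k l hkl
    simp only [T]
    split_ifs with hk hl hl
    · exact min_le_min_right _ (ht hkl)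
    · exact (min_le_right _ _).trans le_self_add
    · exact absurd (hkl.trans hl) hk
    · exact add_le_add le_rfl (ht' (Nat.sub_le_sub_right hkl _))
  have hind := (indepFun_initial_shift (hN.indep.nat hT) (fun i => hN.measurable_sub _ _)
    (Nat.le_succ m)).comp hφ (hψ.comp (Finset.measurable_restrict (Finset.range m')))
  convert hind using 1 <;> ext ω j
  · have := congrFun (φ_eq (fun u => N (min u d) ω) fun u v h => hN.mono ω (min_le_min_right d h)) j
    simp only [zero_min, hN.zero, tsub_zero] at this
    rw [← this, Function.comp_apply]
    congr 1
    ext i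
    have := Finset.mem_range.1 i.2
    simp only [T, if_pos this.le, if_pos (Nat.succ_le_of_lt this)]
  · have := congrFun (ψ_eq (fun r => N (d + r) ω) fun u v h => hN.mono ω (by gcongr)) j
    rw [add_zero] at this
    rw [← this, Function.comp_apply, Function.comp_apply]
    congr 1
    ext i
    have sub_eq : m.succ + i - (m + 1) = i := Nat.add_sub_cancel_left _ _
    have sub_eq' : m.succ + i + 1 - (m + 1) = i + 1 := by omega
    simp only [Finset.restrict, T, if_neg (show ¬ m.succ + i ≤ m by omega),
      if_neg (show ¬ m.succ + i + 1 ≤ m by omega), sub_eq, sub_eq']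

theorem map_future_eq [IsProbabilityMeasure P] (hN : IsPoissonProcess N rate P) (d : ℝ≥0) :
    P.map (fun ω r => N (d + r) ω - N d ω) = P.map (fun ω r => N r ω) := by
  have map_increments {t : ℕ → ℝ≥0} (ht : Monotone t) :
      P.map (fun ω i => N (d + t (i + 1)) ω - N (d + t i) ω) =
        P.map (fun ω i => N (t (i + 1)) ω - N (t i) ω) := by
    have hdt : Monotone fun i => d + t i := fun i j h => add_le_add le_rfl (ht h)
    rw [(hN.indep.nat hdt).map_fun_eq_infinitePi_map fun i => hN.measurable_sub _ _,
      (hN.indep.nat ht).map_fun_eq_infinitePi_map fun i => hN.measurable_sub _ _]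
    congr 1
    ext1 i
    rw [hN.law _ _ (hdt i.le_succ), hN.law _ _ (ht i.le_succ), add_tsub_add_eq_tsub_left]
  refine (map_eq_iff_forall_finset_map_restrict_eq (X := fun r ω => N (d + r) ω - N d ω) (Y := N)
    (measurable_pi_lambda _ fun r => hN.measurable_sub _ _).aemeasurable
    (measurable_pi_lambda _ hN.measurable).aemeasurable).2 fun J => ?_
  obtain ⟨t, m, φ, ht, hφ, φ_eq⟩ := exists_increments_determine J
  have hφ' : Measurable (φ ∘ Finset.restrict (π := fun _ => ℕ) (Finset.range m)) :=
    hφ.comp (Finset.measurable_restrict _)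
  have := congrArg (Measure.map (φ ∘ (Finset.range m).restrict)) (map_increments ht)
  rw [Measure.map_map hφ' (measurable_pi_lambda _ fun i => hN.measurable_sub _ _),
    Measure.map_map hφ' (measurable_pi_lambda _ fun i => hN.measurable_sub _ _)] at this
  convert this using 2 <;> ext ω r
  · have := congrFun (φ_eq (fun r => N (d + r) ω) fun u v h => hN.mono ω (by gcongr)) r
    rw [add_zero] at this
    exact this.symm
  · have := congrFun (φ_eq (fun r => N r ω) (hN.mono ω)) r
    rw [hN.zero, tsub_zero] at this
    exact this.symm

end IsPoissonProcess

theorem StepPath.map_eq_of_eventually_eq {Ω ι : Type*} {mΩ : MeasurableSpace Ω} {μ : Measure Ω}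
    [IsFiniteMeasure μ] {l : Filter ι} [l.NeBot] [l.IsCountablyGenerated] {Y : Ω → StepPath}
    {Z : ι → Ω → StepPath} {ν : Measure StepPath} (hY : Measurable Y) (hZ : ∀ n, Measurable (Z n))
    (hlim : ∀ ω u, ∀ᶠ n in l, Z n ω u = Y ω u) (hν : ∀ n, μ.map (Z n) = ν) : μ.map Y = ν := by
  refine measure_ext_of_map_toFun (IsProjectiveLimit.unique
    (P := fun J => ((μ.map Y).map toFun).map J.restrict) (fun J => rfl) fun J => ?_)
  have hρ : Measurable (J.restrict ∘ toFun) :=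
    (Finset.measurable_restrict (X := fun _ => ℝ) J).comp measurable_toFun
  ext C hC
  dsimp only
  rw [Measure.map_map (Finset.measurable_restrict _) measurable_toFun,
    Measure.map_map (Finset.measurable_restrict _) measurable_toFun, Measure.map_apply hρ hC,
    Measure.map_apply hρ hC, Measure.map_apply hY (hρ hC)]
  have measure_eq (n : ι) :
      μ (Z n ⁻¹' (J.restrict ∘ toFun ⁻¹' C)) = ν (J.restrict ∘ toFun ⁻¹' C) := by
    rw [← hν n, Measure.map_apply (hZ n) (hρ hC)]
  have lim : Tendsto (fun n => μ (Z n ⁻¹' (J.restrict ∘ toFun ⁻¹' C))) l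
      (𝓝 (μ (Y ⁻¹' (J.restrict ∘ toFun ⁻¹' C)))) := by
    refine tendsto_measure_of_tendsto_indicator_of_isFiniteMeasure l μ (fun n => hZ n (hρ hC))
      fun ω => ?_
    filter_upwards [eventually_all.2 fun u : J => hlim ω u] with n hn
    have restrict_eq : (J.restrict ∘ toFun) (Z n ω) = (J.restrict ∘ toFun) (Y ω) := funext hn
    rw [mem_preimage, mem_preimage, mem_preimage, mem_preimage, restrict_eq]
  simp only [measure_eq] at lim
  exact tendsto_nhds_unique tendsto_const_nhds lim

namespace DegenerateRiskModel

variable {Ω : Type*} [mΩ : MeasurableSpace Ω] {P : Measure Ω} (M : DegenerateRiskModel Ω P)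

theorem map_U_shift [IsProbabilityMeasure P] (k : ℕ) :
    P.map (fun ω n => M.U (k + n) ω) = P.map (fun ω n => M.U n ω) := by
  have h := M.U_indep.precomp (g := fun n => k + n) (add_right_injective k)
  rw [iIndepFun.map_fun_eq_infinitePi_map (fun n => M.U_measurable _) h,
    M.U_indep.map_fun_eq_infinitePi_map M.U_measurable]
  congr 1
  ext1 n
  rw [(M.U_ident (k + n)).map_eq, (M.U_ident n).map_eq]

/-- The aggregate claims up to each time, if the `j`-th claim is `z.1 j` and `z.2 r` claims are
made up to time `r`. -/
def compound (z : (ℕ → ℝ) × (ℝ≥0 → ℕ)) (r : ℝ≥0) : ℝ := ∑ j ∈ Finset.range (z.2 r), z.1 j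

theorem measurable_compound : Measurable compound := by
  refine measurable_pi_lambda _ fun r => ?_
  have measurable_sum : Measurable fun p : ℕ × (ℕ → ℝ) => ∑ j ∈ Finset.range p.1, p.2 j :=
    measurable_from_prod_countable_right fun k =>
      Finset.measurable_sum (Finset.range k) fun n _ => measurable_pi_apply n
  have : Measurable fun z : (ℕ → ℝ) × (ℝ≥0 → ℕ) => (z.2 r, z.1) :=
    ((measurable_pi_apply r).comp measurable_snd).prodMk measurable_fst
  exact measurable_sum.comp this

/-- The sizes of all claims and the claim numbers. -/
def claimData (ω : Ω) : (ℕ → ℝ) × (ℝ≥0 → ℕ) := (fun n => M.U n ω, fun r => M.N r ω)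

/-- The sizes of the first `k` claims and the claim numbers up to time `d`. They determine the
claims up to time `d` if there are exactly `k` of them. -/
def pastData (d : ℝ≥0) (k : ℕ) (ω : Ω) : (ℕ → ℝ) × (ℝ≥0 → ℕ) :=
  (fun n => if n < k then M.U n ω else 0, fun u => M.N (min u d) ω)

/-- The sizes of all claims but the first `k` and the claim numbers after time `d`. They determine
the claims after time `d` if there are exactly `k` of them up to that time. -/
def futureData (d : ℝ≥0) (k : ℕ) (ω : Ω) : (ℕ → ℝ) × (ℝ≥0 → ℕ) :=
  (fun n => M.U (k + n) ω, fun r => M.N (d + r) ω - M.N d ω)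

theorem measurable_claimData : Measurable M.claimData :=
  (measurable_pi_lambda _ M.U_measurable).prodMk (measurable_pi_lambda _ M.poisson.measurable)

theorem measurable_pastData (d : ℝ≥0) (k : ℕ) : Measurable (M.pastData d k) :=
  (measurable_pi_lambda _ fun n =>
      (M.U_measurable n).ite (.const (n < k)) measurable_const).prodMk
    (measurable_pi_lambda _ fun _ => M.poisson.measurable _)

theorem measurable_futureData (d : ℝ≥0) (k : ℕ) : Measurable (M.futureData d k) :=
  (measurable_pi_lambda _ fun _ => M.U_measurable _).prodMk
    (measurable_pi_lambda _ fun _ => M.poisson.measurable_sub _ _)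

variable {M} in
theorem stopAt_claimPath_eq_compound {d : ℝ≥0} {k : ℕ} {ω : Ω} (h : M.N d ω = k) :
    ((M.claimPath ω).stopAt d).toFun = compound (M.pastData d k ω) := by
  ext u
  have le_k : M.N (min u d) ω ≤ k := h ▸ M.poisson.mono ω (min_le_right u d)
  change ∑ n ∈ Finset.range (M.N (min u d) ω), M.U n ω = _
  exact Finset.sum_congr rfl fun n hn =>
    (if_pos ((Finset.mem_range.1 hn).trans_le le_k)).symm

variable {M} in
theorem shift_claimPath_eq_compound {d : ℝ≥0} {k : ℕ} {ω : Ω} (h : M.N d ω = k) :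
    ((M.claimPath ω).shift d).toFun = compound (M.futureData d k ω) := by
  ext r
  simp only [StepPath.shift_apply, claimPath_apply, claims, compound, futureData]
  have le_add : M.N d ω ≤ M.N (d + r) ω := M.poisson.mono ω le_self_add
  rw [← Finset.sum_Ico_eq_sub _ le_add, Finset.sum_Ico_eq_sum_range, h]

theorem indepFun_pastData_futureData [IsProbabilityMeasure P] (d : ℝ≥0) (k : ℕ) :
    IndepFun (M.pastData d k) (M.futureData d k) P := by
  have measurable_first : Measurable fun (v : Finset.range k → ℝ) (n : ℕ) =>
      if h : n < k then v ⟨n, Finset.mem_range.2 h⟩ else 0 :=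
    measurable_pi_lambda _ fun n => by
      by_cases h : n < k
      · simpa only [h, dif_pos] using measurable_pi_apply _
      · simpa only [h, dif_neg, not_false_eq_true] using measurable_const
  have measurable_initial : Measurable fun (u : ℕ → ℝ) (n : ℕ) => if n < k then u n else 0 :=
    measurable_pi_lambda _ fun n => (measurable_pi_apply n).ite (.const (n < k)) measurable_const
  have indep_sizes : IndepFun (fun ω n => if n < k then M.U n ω else 0)
      (fun ω n => M.U (k + n) ω) P :=
    (indepFun_initial_shift M.U_indep M.U_measurable le_rfl).comp measurable_first measurable_id
  have indep_sizes_numbers : IndepFun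
      (fun ω => (fun n => if n < k then M.U n ω else 0, fun n => M.U (k + n) ω))
      (fun ω => (fun u => M.N (min u d) ω, fun r => M.N (d + r) ω - M.N d ω)) P :=
    M.U_indep_N.comp (φ := fun u => (fun n => if n < k then u n else 0, fun n => u (k + n)))
      (ψ := fun n => (fun u => n (min u d), fun r => n (d + r) - n d))
      (measurable_initial.prodMk (by fun_prop)) (by fun_prop)
  exact indepFun_prodMk_prodMk (M.measurable_pastData d k).fst (M.measurable_futureData d k).fst
    (M.measurable_pastData d k).snd (M.measurable_futureData d k).snd indep_sizes
    (M.poisson.indepFun_past_future d) indep_sizes_numbers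

theorem map_futureData [IsProbabilityMeasure P] (d : ℝ≥0) (k : ℕ) :
    P.map (M.futureData d k) = P.map M.claimData := by
  have indep_future : IndepFun (fun ω n => M.U (k + n) ω) (fun ω r => M.N (d + r) ω - M.N d ω) P :=
    M.U_indep_N.comp (φ := fun (u : ℕ → ℝ) n => u (k + n))
      (ψ := fun (n : ℝ≥0 → ℕ) r => n (d + r) - n d) (by fun_prop) (by fun_prop)
  have hf := M.measurable_futureData d k
  have hc := M.measurable_claimData
  have map_future := (indepFun_iff_map_prod_eq_prod_map_map hf.fst.aemeasurable
    hf.snd.aemeasurable).1 indep_future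
  have map_all := (indepFun_iff_map_prod_eq_prod_map_map hc.fst.aemeasurable
    hc.snd.aemeasurable).1 M.U_indep_N
  calc P.map (M.futureData d k)
      = (P.map fun ω n => M.U (k + n) ω).prod (P.map fun ω r => M.N (d + r) ω - M.N d ω) :=
        map_future
    _ = (P.map fun ω n => M.U n ω).prod (P.map fun ω r => M.N r ω) := by
        rw [M.map_U_shift k, M.poisson.map_future_eq d]
    _ = P.map M.claimData := map_all.symm

theorem measure_stopAt_inter_shift [IsProbabilityMeasure P] (d : ℝ≥0) {A B : Set StepPath}
    (hA : MeasurableSet A) (hB : MeasurableSet B) :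
    P ((fun ω => (M.claimPath ω).stopAt d) ⁻¹' A ∩ (fun ω => (M.claimPath ω).shift d) ⁻¹' B) =
      P ((fun ω => (M.claimPath ω).stopAt d) ⁻¹' A) * M.pathLaw B := by
  obtain ⟨A, hA, rfl⟩ := hA
  obtain ⟨B, hB, rfl⟩ := hB
  have hcB := measurable_compound hB
  refine measure_inter_eq_mul_of_fibers (M.poisson.measurable d) fun k => ?_
  set Ak : Set ((ℕ → ℝ) × (ℝ≥0 → ℕ)) := compound ⁻¹' A ∩ (fun z => z.2 d) ⁻¹' {k}
  have hAk : MeasurableSet Ak := (measurable_compound hA).inter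
    (((measurable_pi_apply d).comp measurable_snd) (measurableSet_singleton k))
  have past_eq : (fun ω => (M.claimPath ω).stopAt d) ⁻¹' (StepPath.toFun ⁻¹' A) ∩ M.N d ⁻¹' {k} =
      M.pastData d k ⁻¹' Ak := by
    ext ω
    have : (M.pastData d k ω).2 d = M.N d ω := by simp only [pastData, min_self]
    simp only [Ak, mem_inter_iff, mem_preimage, mem_singleton_iff, this]
    exact and_congr_left fun h => by rw [stopAt_claimPath_eq_compound h]
  have future_eq : M.pastData d k ⁻¹' Ak ∩
      (fun ω => (M.claimPath ω).shift d) ⁻¹' (StepPath.toFun ⁻¹' B) =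
        M.pastData d k ⁻¹' Ak ∩ M.futureData d k ⁻¹' (compound ⁻¹' B) := by
    ext ω
    refine and_congr_right fun h => ?_
    have hω : M.N d ω = k := (past_eq.symm.subset h).2
    simp only [mem_preimage, shift_claimPath_eq_compound hω]
  rw [past_eq, future_eq,
    indepFun_iff_measure_inter_preimage_eq_mul.1 (M.indepFun_pastData_futureData d k) _ _ hAk hcB,
    ← Measure.map_apply (M.measurable_futureData d k) hcB, M.map_futureData,
    Measure.map_apply M.measurable_claimData hcB, pathLaw,
    Measure.map_apply M.measurable_claimPath ⟨B, hB, rfl⟩]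
  rfl

theorem exp_le_measure_claims_eq_zero (t : ℝ≥0) :
    ENNReal.ofReal (Real.exp (-(M.rate * t))) ≤ P {ω | M.claims t ω = 0} := by
  have law : P.map (M.N t) = poissonMeasure (M.rate * t) := by
    have := M.poisson.law 0 t zero_le
    simpa only [M.poisson.zero, tsub_zero] using this
  calc ENNReal.ofReal (Real.exp (-(M.rate * t)))
      = P.map (M.N t) {0} := by simp [law, poissonMeasure_singleton]
    _ = P (M.N t ⁻¹' {0}) :=
        Measure.map_apply (M.poisson.measurable t) (measurableSet_singleton 0)
    _ ≤ P {ω | M.claims t ω = 0} := measure_mono fun ω (hω : M.N t ω = 0) => by simp [claims, hω]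

end DegenerateRiskModel

/-- The least multiple of `1 / (n + 1)` that exceeds `T`. -/
def ceilTime (n : ℕ) (T : ℝ≥0) : ℝ≥0 := (⌊T * (n + 1)⌋₊ + 1) / (n + 1)

theorem lt_ceilTime (n : ℕ) (T : ℝ≥0) : T < ceilTime n T := by
  rw [ceilTime, lt_div_iff₀ (by positivity)]
  exact Nat.lt_floor_add_one _

theorem ceilTime_le (n : ℕ) (T : ℝ≥0) : ceilTime n T ≤ T + 1 / (n + 1) := by
  have h : (0 : ℝ≥0) < n + 1 := by positivity
  rw [ceilTime, div_le_iff₀ h, add_mul, one_div, inv_mul_cancel₀ h.ne']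
  gcongr
  exact Nat.floor_le zero_le

theorem tendsto_ceilTime (T : ℝ≥0) : Tendsto (fun n => ceilTime n T) atTop (𝓝[>] T) := by
  have upper : Tendsto (fun n : ℕ => T + 1 / ((n : ℝ≥0) + 1)) atTop (𝓝 (T + 0)) :=
    tendsto_const_nhds.add tendsto_one_div_add_atTop_nhds_zero_nat
  rw [add_zero] at upper
  exact tendsto_nhdsWithin_iff.2 ⟨tendsto_of_tendsto_of_tendsto_of_le_of_le tendsto_const_nhds upper
    (fun n => (lt_ceilTime n T).le) fun n => ceilTime_le n T, .of_forall fun n => lt_ceilTime n T⟩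

theorem measurable_ceilTime (n : ℕ) : Measurable (ceilTime n) :=
  ((measurable_from_nat.comp (Nat.measurable_floor.comp (measurable_id.mul_const _))).add_const
    1).div_const _

theorem StepPath.eventually_shift_eq (s : StepPath) (T u : ℝ≥0) :
    ∀ᶠ v in 𝓝[>] T, s.shift v u = s.shift T u := by
  have add_right : Tendsto (· + u) (𝓝[>] T) (𝓝[>] (T + u)) :=
    tendsto_nhdsWithin_iff.2 ⟨(continuous_add_const u).continuousAt.mono_left nhdsWithin_le_nhds,
      eventually_mem_nhdsWithin.mono fun v (hv : T < v) => by simpa using hv⟩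
  filter_upwards [s.eventually_eq T, add_right.eventually (s.eventually_eq (T + u))] with v hv hvu
  rw [shift_apply, shift_apply, hv, hvu]

namespace DegenerateRiskModel

variable {Ω : Type*} [mΩ : MeasurableSpace Ω] {P : Measure Ω} {M : DegenerateRiskModel Ω P}
  {x : Fin 2 → ℝ} {τ : Ω → WithTop ℝ≥0}

/-- The time `τ` and the claims up to it. On `{τ = ⊤}`, this is a junk value. -/
def past (M : DegenerateRiskModel Ω P) (τ : Ω → WithTop ℝ≥0) (ω : Ω) : ℝ≥0 × StepPath :=
  ((τ ω).untopD 0, (M.claimPath ω).stopAt ((τ ω).untopD 0))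

/-- The claims after time `τ`. On `{τ = ⊤}`, this is a junk value. -/
def future (M : DegenerateRiskModel Ω P) (τ : Ω → WithTop ℝ≥0) (ω : Ω) : StepPath :=
  (M.claimPath ω).shift ((τ ω).untopD 0)

theorem measurable_past (hτ : IsStoppingTime (M.filtration x) τ) : Measurable (M.past τ) :=
  (hτ.measurable'.untopD 0).prodMk
    (StepPath.measurable_stopAt M.measurable_claimPath (hτ.measurable'.untopD 0))

theorem measurable_future (hτ : IsStoppingTime (M.filtration x) τ) : Measurable (M.future τ) :=
  StepPath.measurable_shift M.measurable_claimPath (hτ.measurable'.untopD 0)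

theorem measurableSet_inter_floor_eq (hτ : IsStoppingTime (M.filtration x) τ) {A : Set Ω}
    (hA : A ⊆ {ω | τ ω ≠ ⊤}) (hAτ : ∀ t : ℝ≥0, MeasurableSet[M.filtration x t] (A ∩ {ω | τ ω ≤ t}))
    (n k : ℕ) :
    MeasurableSet[M.filtration x ((k + 1) / (n + 1))]
      (A ∩ (fun ω => ⌊(τ ω).untopD 0 * (n + 1)⌋₊) ⁻¹' {k}) := by
  have hn : (0 : ℝ≥0) < n + 1 := by positivity
  have inter_eq : A ∩ (fun ω => ⌊(τ ω).untopD 0 * (n + 1)⌋₊) ⁻¹' {k} =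
      (A ∩ {ω | τ ω ≤ ((k + 1) / (n + 1) : ℝ≥0)}) ∩ ({ω | τ ω < ((k + 1) / (n + 1) : ℝ≥0)} ∩
        {ω | ((k / (n + 1) : ℝ≥0) : WithTop ℝ≥0) ≤ τ ω}) := by
    ext ω
    simp only [mem_inter_iff, mem_preimage, mem_singleton_iff, mem_ofPred_eq, and_assoc]
    refine and_congr_right fun hω => ?_
    obtain ⟨t, ht⟩ := WithTop.ne_top_iff_exists.1 (hA hω)
    simp only [← ht, WithTop.untopD_coe, WithTop.coe_le_coe, WithTop.coe_lt_coe]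
    rw [Nat.floor_eq_iff zero_le, div_le_iff₀ hn, lt_div_iff₀ hn, le_div_iff₀ hn]
    exact ⟨fun h => ⟨h.2.le, h.2, h.1⟩, fun h => ⟨h.2.2, h.2.1⟩⟩
  rw [inter_eq]
  refine (hAτ _).inter ((hτ.measurableSet_lt _).inter ?_)
  refine (M.filtration x).mono ?_ _ (hτ.measurableSet_ge _)
  exact div_le_div_of_nonneg_right (le_add_of_nonneg_right zero_le) hn.le

theorem map_restrict_shift_ceilTime [IsProbabilityMeasure P]
    (hτ : IsStoppingTime (M.filtration x) τ) {A : Set Ω} (hA : A ⊆ {ω | τ ω ≠ ⊤})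
    (hAτ : ∀ t : ℝ≥0, MeasurableSet[M.filtration x t] (A ∩ {ω | τ ω ≤ t})) (n : ℕ) :
    (P.restrict A).map (fun ω => (M.claimPath ω).shift (ceilTime n ((τ ω).untopD 0))) =
      P A • M.pathLaw := by
  have hT : Measurable fun ω => (τ ω).untopD 0 := hτ.measurable'.untopD 0
  have hshift : Measurable fun ω => (M.claimPath ω).shift (ceilTime n ((τ ω).untopD 0)) :=
    StepPath.measurable_shift M.measurable_claimPath ((measurable_ceilTime n).comp hT)
  ext B hB
  rw [Measure.map_apply hshift hB, Measure.restrict_apply (hshift hB), inter_comm,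
    Measure.smul_apply, smul_eq_mul]
  refine measure_inter_eq_mul_of_fibers (Nat.measurable_floor.comp (hT.mul_const (n + 1 : ℝ≥0)))
    fun k => ?_
  have shift_eq : A ∩ (fun ω => ⌊(τ ω).untopD 0 * (n + 1)⌋₊) ⁻¹' {k} ∩
      (fun ω => (M.claimPath ω).shift (ceilTime n ((τ ω).untopD 0))) ⁻¹' B =
        A ∩ (fun ω => ⌊(τ ω).untopD 0 * (n + 1)⌋₊) ⁻¹' {k} ∩
          (fun ω => (M.claimPath ω).shift ((k + 1) / (n + 1))) ⁻¹' B := by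
    ext ω
    refine and_congr_right fun h => ?_
    rw [mem_preimage, mem_preimage, ceilTime, show ⌊(τ ω).untopD 0 * (n + 1)⌋₊ = k from h.2]
  have hAk := measurableSet_inter_floor_eq hτ hA hAτ n k
  rw [filtration_eq_comap] at hAk
  obtain ⟨C, hC, hCA⟩ := hAk
  change P (A ∩ (fun ω => ⌊(τ ω).untopD 0 * (n + 1)⌋₊) ⁻¹' {k} ∩ _) = _
  rw [shift_eq, ← hCA, M.measure_stopAt_inter_shift _ hC hB, hCA]
  rfl

/- The strong Markov property at `τ`: by right-continuity it is inherited from the discretizations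
of `τ` from above, which take countably many values. -/
theorem map_restrict_future [IsProbabilityMeasure P]
    (hτ : IsStoppingTime (M.filtration x) τ) {A : Set Ω} (hA : A ⊆ {ω | τ ω ≠ ⊤})
    (hAτ : ∀ t : ℝ≥0, MeasurableSet[M.filtration x t] (A ∩ {ω | τ ω ≤ t})) :
    (P.restrict A).map (M.future τ) = P A • M.pathLaw :=
  StepPath.map_eq_of_eventually_eq (l := atTop) (measurable_future hτ)
    (fun n => StepPath.measurable_shift M.measurable_claimPath
      ((measurable_ceilTime n).comp (hτ.measurable'.untopD 0)))
    (fun ω u => (tendsto_ceilTime _).eventually ((M.claimPath ω).eventually_shift_eq _ u))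
    fun n => map_restrict_shift_ceilTime hτ hA hAτ n

theorem past_min_const_le (τ : Ω → WithTop ℝ≥0) (t : ℝ≥0) (ω : Ω) :
    (M.past (fun ω => min (τ ω) t) ω).1 ≤ t :=
  (WithTop.untopD_le_iff fun h => absurd h
    ((min_le_right (τ ω) t).trans_lt (WithTop.coe_lt_top t)).ne).2 (min_le_right _ _)

theorem measurable_past_min_const (hτ : IsStoppingTime (M.filtration x) τ) (t : ℝ≥0) :
    Measurable[M.filtration x t] (M.past fun ω => min (τ ω) t) := by
  have hT : Measurable[M.filtration x t] fun ω => (min (τ ω) t).untopD 0 :=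
    ((hτ.min_const t).measurable_of_le fun _ => min_le_right _ _).untopD 0
  have past_eq : (M.past fun ω => min (τ ω) t) = fun ω => ((min (τ ω) t).untopD 0,
      ((M.claimPath ω).stopAt t).stopAt ((min (τ ω) t).untopD 0)) := by
    refine funext fun ω => Prod.ext rfl (StepPath.ext fun r => ?_)
    have le_t : (min (τ ω) t).untopD 0 ≤ t := past_min_const_le (M := M) τ t ω
    simp only [past, StepPath.stopAt_apply, min_assoc, min_eq_left le_t]
  rw [past_eq]
  exact hT.prodMk (StepPath.measurable_stopAt (M.measurable_stopAt_claimPath x t) hT)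

theorem measurableSet_past_preimage_inter (hτ : IsStoppingTime (M.filtration x) τ)
    {C : Set (ℝ≥0 × StepPath)} (hC : MeasurableSet C) (t : ℝ≥0) :
    MeasurableSet[M.filtration x t] (M.past τ ⁻¹' C ∩ {ω | τ ω ≠ ⊤} ∩ {ω | τ ω ≤ t}) := by
  convert (measurable_past_min_const hτ t hC).inter (hτ t) using 1
  ext ω
  simp only [mem_inter_iff, mem_preimage, mem_ofPred_eq]
  refine and_congr_left fun hω => ?_
  rw [past, past, min_eq_left hω, and_iff_left (hω.trans_lt (WithTop.coe_lt_top t)).ne]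

theorem map_past_future [IsProbabilityMeasure P] (hτ : IsStoppingTime (M.filtration x) τ) :
    (P.restrict {ω | τ ω ≠ ⊤}).map (fun ω => (M.past τ ω, M.future τ ω)) =
      ((P.restrict {ω | τ ω ≠ ⊤}).map (M.past τ)).prod M.pathLaw := by
  have hm := (measurable_past hτ).prodMk (measurable_future hτ)
  refine (Measure.prod_eq fun C B hC hB => ?_).symm
  have := congrArg (fun μ => μ B) (map_restrict_future hτ
    (A := M.past τ ⁻¹' C ∩ {ω | τ ω ≠ ⊤}) inter_subset_right
    (measurableSet_past_preimage_inter hτ hC))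
  rw [Measure.map_apply hm (hC.prod hB), Measure.restrict_apply (hm (hC.prod hB)),
    Measure.map_apply (measurable_past hτ) hC, Measure.restrict_apply (measurable_past hτ hC),
    mk_preimage_prod, inter_comm (M.past τ ⁻¹' C), inter_assoc]
  simpa only [Measure.map_apply (measurable_future hτ) hB,
    Measure.restrict_apply (measurable_future hτ hB), Measure.smul_apply, smul_eq_mul] using this

theorem lintegral_past_future [IsProbabilityMeasure P] (hτ : IsStoppingTime (M.filtration x) τ)
    {h : (ℝ≥0 × StepPath) × StepPath → ℝ≥0∞} (hh : Measurable h) :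
    ∫⁻ ω in {ω | τ ω ≠ ⊤}, h (M.past τ ω, M.future τ ω) ∂P =
      ∫⁻ ω in {ω | τ ω ≠ ⊤}, (∫⁻ s, h (M.past τ ω, s) ∂M.pathLaw) ∂P := by
  rw [← lintegral_map hh ((measurable_past hτ).prodMk (measurable_future hτ)), map_past_future hτ,
    lintegral_prod _ hh.aemeasurable, lintegral_map hh.lintegral_prod_right' (measurable_past hτ)]

theorem ae_past_future [IsProbabilityMeasure P] (hτ : IsStoppingTime (M.filtration x) τ)
    {p : (ℝ≥0 × StepPath) × StepPath → Prop} (hp : MeasurableSet {z | p z}) :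
    (∀ᵐ ω ∂P.restrict {ω | τ ω ≠ ⊤}, p (M.past τ ω, M.future τ ω)) ↔
      ∀ᵐ ω ∂P.restrict {ω | τ ω ≠ ⊤}, ∀ᵐ s ∂M.pathLaw, p (M.past τ ω, s) := by
  have hq : MeasurableSet {y | ∀ᵐ s ∂M.pathLaw, p (y, s)} :=
    (measurable_measure_prodMk_left (ν := M.pathLaw) hp.compl) (measurableSet_singleton 0)
  rw [← ae_map_iff ((measurable_past hτ).prodMk (measurable_future hτ)).aemeasurable hp,
    map_past_future hτ, Measure.ae_prod_iff_ae_ae hp,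
    ae_map_iff (measurable_past hτ).aemeasurable hq]

theorem concat_past_future (ω : Ω) :
    StepPath.concat (M.past τ ω).1 (M.past τ ω).2 (M.future τ ω) = M.claimPath ω :=
  StepPath.concat_stopAt_shift _ _

/-- The discount factor `e^{-q T}`. -/
def discount (M : DegenerateRiskModel Ω P) (T : ℝ≥0) : ℝ≥0∞ := ENNReal.ofReal (Real.exp (-M.q * T))

theorem measurable_discount : Measurable M.discount := by
  unfold discount
  fun_prop

theorem discount_le_one (T : ℝ≥0) : M.discount T ≤ 1 := by
  rw [discount, ENNReal.ofReal_le_one, Real.exp_le_one_iff, neg_mul, neg_nonpos]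
  exact mul_nonneg M.q_pos.le T.coe_nonneg

theorem pathPayoff_zero : M.pathPayoff (fun _ _ => 0) = 0 := by
  simp only [pathPayoff, payoff_zero, Finset.sum_const_zero]

theorem pathPayoff_paste {f g : ℝ≥0 → Fin 2 → ℝ} (hf : ∀ i, IsDividendPath fun t => f t i)
    (hg : ∀ i, IsDividendPath fun t => g t i) (T : ℝ≥0) :
    M.pathPayoff (fun t i => f (min t T) i + g (t - T) i) =
      M.pathPayoff (fun t i => f (min t T) i) + M.discount T * M.pathPayoff g := by
  simp only [pathPayoff]
  rw [Finset.mul_sum, ← Finset.sum_add_distrib]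
  exact Finset.sum_congr rfl fun i _ => payoff_paste M.q (hf i) (hg i) T

/-- The discounted payments of a rule before time `τ`. -/
def stoppedPayoff (M : DegenerateRiskModel Ω P) (F : PathStrategy) (τ : Ω → WithTop ℝ≥0) (ω : Ω) :
    ℝ≥0∞ :=
  M.pathPayoff fun t i => F (M.claimPath ω) ((min (t : WithTop ℝ≥0) (τ ω)).untopD 0) i

theorem stoppedPayoff_of_eq_top (F : PathStrategy) {ω : Ω} (h : τ ω = ⊤) :
    M.stoppedPayoff F τ ω = M.pathPayoff (F (M.claimPath ω)) := by
  simp only [stoppedPayoff, h, min_eq_left le_top, WithTop.untopD_coe]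

theorem stoppedPayoff_of_ne_top (F : PathStrategy) {ω : Ω} (h : τ ω ≠ ⊤) :
    M.stoppedPayoff F τ ω =
      M.pathPayoff fun t i => F (M.claimPath ω) (min t (M.past τ ω).1) i := by
  obtain ⟨T, hT⟩ := WithTop.ne_top_iff_exists.1 h
  simp only [stoppedPayoff, past, ← hT, ← WithTop.coe_min, WithTop.untopD_coe]

theorem measurable_stoppedPayoff (hτ : IsStoppingTime (M.filtration x) τ) (F : PathStrategy) :
    Measurable (M.stoppedPayoff F τ) :=
  measurable_pathPayoff fun i => F.measurable_eval_comp
    (M.measurable_claimPath.comp measurable_fst)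
    (((WithTop.measurable_coe.comp measurable_snd).min
      (hτ.measurable'.comp measurable_fst)).untopD 0) i

theorem measurableSet_ne_top (hτ : IsStoppingTime (M.filtration x) τ) :
    MeasurableSet {ω | τ ω ≠ ⊤} :=
  hτ.measurableSet_eq_top.compl

/-- The expected discounted value of following the rule `F` up to time `τ` and then receiving a
reward `W` that depends on `τ` and on the claims up to `τ`. -/
def valueWithReward (M : DegenerateRiskModel Ω P) (F : PathStrategy) (τ : Ω → WithTop ℝ≥0)
    (W : ℝ≥0 × StepPath → ℝ≥0∞) : ℝ≥0∞ :=
  ∫⁻ ω, M.stoppedPayoff F τ ω ∂P +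
    ∫⁻ ω in {ω | τ ω ≠ ⊤}, M.discount (M.past τ ω).1 * W (M.past τ ω) ∂P

theorem valueWithReward_mono_ae {F : PathStrategy} {W W' : ℝ≥0 × StepPath → ℝ≥0∞}
    (h : ∀ᵐ ω ∂P.restrict {ω | τ ω ≠ ⊤}, W (M.past τ ω) ≤ W' (M.past τ ω)) :
    M.valueWithReward F τ W ≤ M.valueWithReward F τ W' := by
  refine add_le_add le_rfl (lintegral_mono_ae (h.mono fun ω hω => ?_))
  gcongr

theorem valueWithReward_mul_add_le [IsProbabilityMeasure P] (F : PathStrategy)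
    (τ : Ω → WithTop ℝ≥0) (W : ℝ≥0 × StepPath → ℝ≥0∞) {A δ : ℝ≥0∞} (hA : 1 ≤ A) (hA' : A ≠ ∞) :
    M.valueWithReward F τ (fun p => A * (W p + δ)) ≤ A * (M.valueWithReward F τ W + δ) := by
  set R : Ω → ℝ≥0∞ := fun ω => M.discount (M.past τ ω).1 * W (M.past τ ω)
  have reward_le : ∫⁻ ω in {ω | τ ω ≠ ⊤}, M.discount (M.past τ ω).1 * (A * (W (M.past τ ω) + δ)) ∂P
      ≤ A * (∫⁻ ω in {ω | τ ω ≠ ⊤}, R ω ∂P + δ) :=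
    calc _ ≤ ∫⁻ ω in {ω | τ ω ≠ ⊤}, A * (R ω + δ) ∂P := by
          refine lintegral_mono fun ω => ?_
          rw [mul_left_comm, mul_add]
          gcongr
          exact mul_le_of_le_one_left zero_le (discount_le_one _)
      _ = A * (∫⁻ ω in {ω | τ ω ≠ ⊤}, R ω ∂P + ∫⁻ _ in {ω | τ ω ≠ ⊤}, δ ∂P) := by
          rw [lintegral_const_mul' _ _ hA', lintegral_add_right _ measurable_const]
      _ ≤ _ := by
          rw [setLIntegral_const]
          gcongr
          exact mul_le_of_le_one_right zero_le prob_le_one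
  calc _ ≤ A * ∫⁻ ω, M.stoppedPayoff F τ ω ∂P + A * (∫⁻ ω in {ω | τ ω ≠ ⊤}, R ω ∂P + δ) :=
        add_le_add (le_mul_of_one_le_left zero_le hA) reward_le
    _ = A * (M.valueWithReward F τ W + δ) := by rw [← mul_add, ← add_assoc, valueWithReward]

/-- The payments of the strategy that follows the rule `F` up to time `τ` and then the rule that `G`
selects on the basis of `τ` and the claims up to `τ`. They are encoded through `min (τ ω) t` rather
than `τ ω` in order to depend only on what is known at time `t`. -/
def pasted (M : DegenerateRiskModel Ω P) (F : PathStrategy) (G : ℝ≥0 × StepPath → PathStrategy)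
    (τ : Ω → WithTop ℝ≥0) (t : ℝ≥0) (ω : Ω) (i : Fin 2) : ℝ :=
  let σ : Ω → WithTop ℝ≥0 := fun ω => min (τ ω) t
  F (M.claimPath ω) (M.past σ ω).1 i + G (M.past σ ω) (M.future σ ω) (t - (M.past σ ω).1) i

section pasted

variable (F : PathStrategy) (G : ℝ≥0 × StepPath → PathStrategy)

theorem pasted_of_eq_top {ω : Ω} (h : τ ω = ⊤) :
    (fun t => M.pasted F G τ t ω) = F (M.claimPath ω) := by
  ext t i
  simp only [pasted, past, h, min_eq_right le_top, WithTop.untopD_coe, tsub_self]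
  rw [((G _).isDividendPath _ i).zero, add_zero]

theorem pasted_of_ne_top {ω : Ω} (h : τ ω ≠ ⊤) :
    (fun t => M.pasted F G τ t ω) = fun t i =>
      F (M.claimPath ω) (min t (M.past τ ω).1) i +
        G (M.past τ ω) (M.future τ ω) (t - (M.past τ ω).1) i := by
  obtain ⟨T, hT⟩ := WithTop.ne_top_iff_exists.1 h
  ext t i
  simp only [pasted, past, future, ← hT, ← WithTop.coe_min, WithTop.untopD_coe]
  rcases le_total T t with hTt | htT
  · rw [min_eq_left hTt, min_eq_right hTt]
  · rw [min_eq_right htT, min_eq_left htT, tsub_self, tsub_eq_zero_of_le htT,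
      ((G _).isDividendPath _ i).zero, ((G _).isDividendPath _ i).zero]

theorem isDividendPath_pasted (ω : Ω) (i : Fin 2) :
    IsDividendPath fun t => M.pasted F G τ t ω i := by
  rcases eq_or_ne (τ ω) ⊤ with h | h
  · simp only [fun t => congrFun (congrFun (pasted_of_eq_top (M := M) F G h) t) i]
    exact F.isDividendPath _ i
  · simp only [fun t => congrFun (congrFun (pasted_of_ne_top (M := M) F G h) t) i]
    exact (F.isDividendPath _ i).paste ((G _).isDividendPath _ i) _

variable {G}

theorem measurable_pasted (hτ : IsStoppingTime (M.filtration x) τ)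
    (hG : PathStrategy.IsMeasurableFamily G) (t : ℝ≥0) (i : Fin 2) :
    Measurable[M.filtration x t] fun ω => M.pasted F G τ t ω i := by
  set p : Ω → ℝ≥0 × StepPath := M.past fun ω => min (τ ω) t
  have hp : Measurable[M.filtration x t] p := measurable_past_min_const hτ t
  have hS := M.measurable_stopAt_claimPath x t
  have pasted_eq : (fun ω => M.pasted F G τ t ω i) = fun ω =>
      F ((M.claimPath ω).stopAt t) (p ω).1 i +
        G (p ω) (((M.claimPath ω).stopAt t).shift (p ω).1) (t - (p ω).1) i := by
    ext ω
    have le_t : (p ω).1 ≤ t := past_min_const_le τ t ω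
    have hF : F (M.claimPath ω) (p ω).1 = F ((M.claimPath ω).stopAt t) (p ω).1 :=
      F.eq_of_le (fun u hu => by rw [StepPath.stopAt_apply, min_eq_left (hu.trans le_t)]) le_rfl
    have hG' : G (p ω) ((M.claimPath ω).shift (p ω).1) (t - (p ω).1) =
        G (p ω) (((M.claimPath ω).stopAt t).shift (p ω).1) (t - (p ω).1) :=
      (G (p ω)).eq_of_le (fun u hu => by
        simp only [StepPath.shift_apply, StepPath.stopAt_apply, min_eq_left le_t,
          min_eq_left ((le_tsub_iff_left le_t).1 hu)]) le_rfl
    rw [← hF, ← hG']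
    rfl
  rw [pasted_eq]
  exact (F.measurable_eval_comp hS hp.fst i).add (hG.measurable_eval_comp hp
    (StepPath.measurable_shift hS hp.fst) (measurable_const.sub hp.fst) i)

theorem pasted_continuation (ω : Ω) :
    (fun t => M.pasted F (fun p => F.continuation p.1 p.2) τ t ω) = F (M.claimPath ω) := by
  ext t i
  set σ : Ω → WithTop ℝ≥0 := fun ω => min (τ ω) t
  change F (M.claimPath ω) (M.past σ ω).1 i +
    (F (.concat _ _ (M.future σ ω)) ((M.past σ ω).1 + (t - (M.past σ ω).1)) i -
      F (.concat _ _ (M.future σ ω)) (M.past σ ω).1 i) = _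
  rw [concat_past_future, add_tsub_cancel_of_le (past_min_const_le τ t ω), add_sub_cancel]

variable (G)

theorem pathPayoff_pasted (ω : Ω) :
    M.pathPayoff (fun t => M.pasted F G τ t ω) = M.stoppedPayoff F τ ω +
      {ω | τ ω ≠ ⊤}.indicator
        (fun ω => M.discount (M.past τ ω).1 * M.pathPayoff (G (M.past τ ω) (M.future τ ω))) ω := by
  by_cases hω : ω ∈ {ω | τ ω ≠ ⊤}
  · rw [indicator_of_mem hω, stoppedPayoff_of_ne_top F hω, pasted_of_ne_top F G hω]
    exact pathPayoff_paste (F.isDividendPath _) ((G _).isDividendPath _) _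
  · rw [indicator_of_notMem hω, add_zero, stoppedPayoff_of_eq_top F (not_not.1 hω),
      pasted_of_eq_top F G (not_not.1 hω)]

variable {G}

theorem lintegral_pathPayoff_pasted [IsProbabilityMeasure P]
    (hτ : IsStoppingTime (M.filtration x) τ) (hG : PathStrategy.IsMeasurableFamily G) :
    ∫⁻ ω, M.pathPayoff (fun t => M.pasted F G τ t ω) ∂P =
      M.valueWithReward F τ fun p => M.ruleValue (G p) := by
  have reward_measurable : Measurable fun z : (ℝ≥0 × StepPath) × StepPath =>
      M.discount z.1.1 * M.pathPayoff (G z.1 z.2) :=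
    (measurable_discount.comp (by fun_prop)).mul (measurable_pathPayoff fun i =>
      hG.measurable_eval_comp (by fun_prop) (by fun_prop) (by fun_prop) i)
  rw [lintegral_congr (pathPayoff_pasted F G), lintegral_add_left (measurable_stoppedPayoff hτ F),
    lintegral_indicator (measurableSet_ne_top hτ), lintegral_past_future hτ reward_measurable]
  exact congrArg _ (lintegral_congr fun ω => lintegral_const_mul (μ := M.pathLaw)
    (M.discount (M.past τ ω).1) (measurable_pathPayoff_rule (G (M.past τ ω))))

theorem ruleValue_eq_valueWithReward [IsProbabilityMeasure P]
    (hτ : IsStoppingTime (M.filtration x) τ) :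
    M.ruleValue F = M.valueWithReward F τ fun p => M.ruleValue (F.continuation p.1 p.2) := by
  rw [← lintegral_pathPayoff_pasted F hτ (.continuation F), ruleValue_eq]
  simp only [pasted_continuation]

end pasted

/-- The controlled surplus at time `p.1` after the claims `p.2` if dividends follow the rule `F`. -/
def surplusAt (M : DegenerateRiskModel Ω P) (x : Fin 2 → ℝ) (F : PathStrategy)
    (p : ℝ≥0 × StepPath) (i : Fin 2) : ℝ :=
  M.pathSurplus x p.2 p.1 i - F p.2 p.1 i

open Classical in
/-- The optimal value at the controlled surplus reached at time `p.1` after the claims `p.2`. It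
is zero if ruin has occurred by then, even if the surplus is back in the solvency set. -/
def valueAt (M : DegenerateRiskModel Ω P) (x : Fin 2 → ℝ) (F : PathStrategy)
    (p : ℝ≥0 × StepPath) : ℝ≥0∞ :=
  if M.Alive x p.2 (F p.2) p.1 then M.value (M.surplusAt x F p) else 0

theorem measurable_surplusAt (x : Fin 2 → ℝ) (F : PathStrategy) : Measurable (M.surplusAt x F) :=
  measurable_pi_lambda _ fun i =>
    (measurable_pathSurplus measurable_const measurable_snd measurable_fst i).sub
      (F.measurable_eval i)

theorem surplusAt_congr {F : PathStrategy} {s s' : StepPath} {T : ℝ≥0} (h : ∀ u ≤ T, s u = s' u) :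
    M.surplusAt x F (T, s) = M.surplusAt x F (T, s') := by
  ext i
  rw [surplusAt, surplusAt, pathSurplus_congr (h T le_rfl), F.eq_of_le h le_rfl]

theorem surplusAt_mem_solvencySet {F : PathStrategy} {p : ℝ≥0 × StepPath}
    (h : M.Alive x p.2 (F p.2) p.1) : M.surplusAt x F p ∈ solvencySet := by
  intro hneg
  obtain ⟨i, hi⟩ := h p.1 le_rfl
  exact absurd (hneg i) (not_lt.2 (sub_nonneg.2 hi))

theorem valueAt_of_alive {F : PathStrategy} {p : ℝ≥0 × StepPath} (h : M.Alive x p.2 (F p.2) p.1) :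
    M.valueAt x F p = M.value (M.surplusAt x F p) := if_pos h

theorem valueAt_of_not_alive {F : PathStrategy} {p : ℝ≥0 × StepPath}
    (h : ¬ M.Alive x p.2 (F p.2) p.1) : M.valueAt x F p = 0 := if_neg h

theorem claimPath_eq_past (τ : Ω → WithTop ℝ≥0) (ω : Ω) :
    ∀ u ≤ (M.past τ ω).1, M.claimPath ω u = (M.past τ ω).2 u := fun _ hu =>
  congrArg (M.claimPath ω) (min_eq_left hu).symm

theorem surplusAt_past (F : PathStrategy) (ω : Ω) :
    M.surplusAt x F (M.past τ ω) = M.surplusAt x F ((M.past τ ω).1, M.claimPath ω) :=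
  (surplusAt_congr (claimPath_eq_past τ ω)).symm

theorem alive_past (F : PathStrategy) (ω : Ω) :
    M.Alive x (M.past τ ω).2 (F (M.past τ ω).2) (M.past τ ω).1 ↔
      M.Alive x (M.claimPath ω) (F (M.claimPath ω)) (M.past τ ω).1 :=
  (alive_congr F (claimPath_eq_past τ ω)).symm

theorem PathAdmissible.continuation {F : PathStrategy} {p : ℝ≥0 × StepPath} {s : StepPath}
    (h : M.PathAdmissible x (.concat p.1 p.2 s) (F (.concat p.1 p.2 s))) :
    M.PathAdmissible (M.surplusAt x F p) s (F.continuation p.1 p.2 s) := by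
  have surplus_eq : M.surplusAt x F p = M.surplusAt x F (p.1, .concat p.1 p.2 s) :=
    surplusAt_congr fun u hu => (StepPath.concat_of_le _ _ hu).symm
  have := h.shift p.1
  rw [StepPath.shift_concat] at this
  rwa [surplus_eq]

theorem continuation_eq_zero {F : PathStrategy} {p : ℝ≥0 × StepPath} {s : StepPath}
    (h : M.PathAdmissible x (.concat p.1 p.2 s) (F (.concat p.1 p.2 s)))
    (hA : ¬ M.Alive x p.2 (F p.2) p.1) : F.continuation p.1 p.2 s = fun _ _ => 0 := by
  rw [← alive_congr F fun u hu => StepPath.concat_of_le p.2 s hu, Alive] at hA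
  push Not at hA
  obtain ⟨r, hr, ruined⟩ := hA
  ext t i
  change F _ (p.1 + t) i - F _ p.1 i = 0
  rw [h.stopped r (p.1 + t) (hr.trans le_self_add) ruined i, h.stopped r p.1 hr ruined i, sub_self]

theorem ruleValue_continuation_le_valueAt {F : PathStrategy} {p : ℝ≥0 × StepPath}
    (h : ∀ᵐ s ∂M.pathLaw, M.PathAdmissible x (.concat p.1 p.2 s) (F (.concat p.1 p.2 s))) :
    M.ruleValue (F.continuation p.1 p.2) ≤ M.valueAt x F p := by
  by_cases hA : M.Alive x p.2 (F p.2) p.1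
  · rw [valueAt_of_alive hA]
    exact ruleValue_le_value (surplusAt_mem_solvencySet hA) (h.mono fun s hs => hs.continuation)
  · have ruleValue_eq_zero : M.ruleValue (F.continuation p.1 p.2) = 0 :=
      (lintegral_congr_ae (h.mono fun s hs => by
        rw [continuation_eq_zero hs hA, pathPayoff_zero])).trans lintegral_zero
    exact ruleValue_eq_zero.trans_le zero_le

theorem AdmissibleRule.ruleValue_le_valueWithReward [IsProbabilityMeasure P] {F : PathStrategy}
    (hF : M.AdmissibleRule x F) (hτ : IsStoppingTime (M.filtration x) τ) :
    M.ruleValue F ≤ M.valueWithReward F τ (M.valueAt x F) := by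
  have concat_measurable : Measurable fun z : (ℝ≥0 × StepPath) × StepPath =>
      StepPath.concat z.1.1 z.1.2 z.2 :=
    StepPath.measurable_concat (by fun_prop) (by fun_prop) (by fun_prop)
  have admissible_concat : ∀ᵐ ω ∂P.restrict {ω | τ ω ≠ ⊤}, ∀ᵐ s ∂M.pathLaw,
      M.PathAdmissible x (.concat (M.past τ ω).1 (M.past τ ω).2 s)
        (F (.concat (M.past τ ω).1 (M.past τ ω).2 s)) := by
    refine (ae_past_future hτ (p := fun z => M.PathAdmissible x (.concat z.1.1 z.1.2 z.2)
      (F (.concat z.1.1 z.1.2 z.2))) (measurableSet_pathAdmissible measurable_const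
        concat_measurable (fun t i => (F.measurable_apply t i).comp concat_measurable)
        fun _ => F.isDividendPath _)).1 (ae_restrict_of_ae ?_)
    simpa only [concat_past_future] using admissibleRule_iff.1 hF
  rw [ruleValue_eq_valueWithReward F hτ]
  exact valueWithReward_mono_ae (admissible_concat.mono fun ω => ruleValue_continuation_le_valueAt)

section dividends

variable {L : ℝ≥0 → Ω → Fin 2 → ℝ} {F : PathStrategy} {ω : Ω}

theorem value_of_neg {y : Fin 2 → ℝ} (h : ∀ i, y i < 0) : M.value y = 0 :=
  if_neg fun hy => hy h

theorem discountedValue_ruinTime (h : M.PathAdmissible x (M.claimPath ω) fun t => L t ω) :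
    M.discountedValue x L (M.ruinTime x L ω) ω = 0 := by
  rcases eq_or_ne (M.ruinTime x L ω) ⊤ with htop | hne
  · rw [discountedValue, if_pos htop]
  · obtain ⟨r, hr⟩ := WithTop.ne_top_iff_exists.1 hne
    rw [← hr, discountedValue, if_neg WithTop.coe_ne_top, WithTop.untopD_coe, value_of_neg,
      mul_zero]
    exact fun i => sub_neg.2 (h.neg_at_ruin hr.symm i)

theorem discountedValue_min_ruinTime (hx : x ∈ solvencySet)
    (hL : (fun t => L t ω) = F (M.claimPath ω))
    (h : M.PathAdmissible x (M.claimPath ω) fun t => L t ω) :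
    M.discountedValue x L (min (τ ω) (M.ruinTime x L ω)) ω =
      {ω | τ ω ≠ ⊤}.indicator
        (fun ω => M.discount (M.past τ ω).1 * M.valueAt x F (M.past τ ω)) ω := by
  by_cases hω : ω ∈ {ω | τ ω ≠ ⊤}
  · obtain ⟨T, hT⟩ := WithTop.ne_top_iff_exists.1 hω
    have past_fst : (M.past τ ω).1 = T := by rw [past, ← hT, WithTop.untopD_coe]
    have lt_ruin_iff : (T : WithTop ℝ≥0) < M.ruinTime x L ω ↔
        M.Alive x (M.past τ ω).2 (F (M.past τ ω).2) (M.past τ ω).1 := by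
      rw [alive_past, past_fst, ← hL]
      refine h.lt_pathRuinTime_iff hx (fun i => ?_) T
      rw [congrFun hL 0]
      exact (F.isDividendPath _ i).zero
    rw [indicator_of_mem hω, ← hT]
    by_cases hA : (T : WithTop ℝ≥0) < M.ruinTime x L ω
    · rw [min_eq_left hA.le, discountedValue, if_neg WithTop.coe_ne_top, WithTop.untopD_coe,
        valueAt_of_alive (lt_ruin_iff.1 hA), surplusAt_past, past_fst, discount]
      refine congrArg _ (congrArg _ (funext fun i => ?_))
      rw [surplusAt, ← hL]
      rfl
    · rw [min_eq_right (not_lt.1 hA), discountedValue_ruinTime h,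
        valueAt_of_not_alive (mt lt_ruin_iff.2 hA), mul_zero]
  · rw [indicator_of_notMem hω, not_not.1 hω, min_eq_right le_top, discountedValue_ruinTime h]

theorem dividends_min_ruinTime (hL : (fun t => L t ω) = F (M.claimPath ω))
    (h : M.PathAdmissible x (M.claimPath ω) fun t => L t ω) :
    M.dividends L (min (τ ω) (M.ruinTime x L ω)) ω = M.stoppedPayoff F τ ω := by
  have hd : ∀ i, IsDividendPath fun t => L t ω i := by
    intro i
    simp only [fun t => congrFun hL t]
    exact F.isDividendPath _ i
  rw [stoppedPayoff, ← hL]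
  exact h.sum_discountedIntegral hd (τ ω)

theorem lintegral_dividends_add_discountedValue (hx : x ∈ solvencySet)
    (hτ : IsStoppingTime (M.filtration x) τ) (hF : M.AdmissibleRule x F)
    (hL : ∀ᵐ ω ∂P, (fun t => L t ω) = F (M.claimPath ω)) :
    ∫⁻ ω, (M.dividends L (min (τ ω) (M.ruinTime x L ω)) ω +
        M.discountedValue x L (min (τ ω) (M.ruinTime x L ω)) ω) ∂P =
      M.valueWithReward F τ (M.valueAt x F) := by
  rw [valueWithReward, ← lintegral_indicator (measurableSet_ne_top hτ),
    ← lintegral_add_left (measurable_stoppedPayoff hτ F)]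
  refine lintegral_congr_ae ?_
  filter_upwards [hL, admissibleRule_iff.1 hF] with ω hω hadm
  rw [← hω] at hadm
  rw [dividends_min_ruinTime hω hadm, discountedValue_min_ruinTime hx hω hadm]

end dividends

theorem pathAdmissible_pasted {F : PathStrategy} {G : ℝ≥0 × StepPath → PathStrategy} {ω : Ω}
    (hF : M.PathAdmissible x (M.claimPath ω) (F (M.claimPath ω)))
    (hG : τ ω ≠ ⊤ → M.PathAdmissible (M.surplusAt x F (M.past τ ω)) (M.future τ ω)
      (G (M.past τ ω) (M.future τ ω)))
    (halive : τ ω ≠ ⊤ → G (M.past τ ω) = PathStrategy.zero ∨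
      M.Alive x (M.past τ ω).2 (F (M.past τ ω).2) (M.past τ ω).1) :
    M.PathAdmissible x (M.claimPath ω) fun t => M.pasted F G τ t ω := by
  rcases eq_or_ne (τ ω) ⊤ with h | h
  · rwa [pasted_of_eq_top F G h]
  · rw [pasted_of_ne_top F G h]
    rcases halive h with hzero | halive
    · rw [hzero]
      simpa only [PathStrategy.zero, add_zero] using hF.paste_zero (M.past τ ω).1
    · have future_admissible := hG h
      rw [surplusAt_past] at future_admissible
      exact hF.paste (fun i => ((G _).isDividendPath _ i).zero) future_admissible
        ((alive_past F ω).1 halive)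

theorem pasted_le_value [IsProbabilityMeasure P] {F : PathStrategy}
    {G : ℝ≥0 × StepPath → PathStrategy} (hx : x ∈ solvencySet)
    (hτ : IsStoppingTime (M.filtration x) τ) (hF : M.AdmissibleRule x F)
    (hG : PathStrategy.IsMeasurableFamily G)
    (hadm : ∀ p, M.AdmissibleRule (M.surplusAt x F p) (G p))
    (halive : ∀ᵐ ω ∂P, τ ω ≠ ⊤ → G (M.past τ ω) = PathStrategy.zero ∨
      M.Alive x (M.past τ ω).2 (F (M.past τ ω).2) (M.past τ ω).1) :
    M.valueWithReward F τ (fun p => M.ruleValue (G p)) ≤ M.value x := by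
  have admissible_measurable : MeasurableSet {z : (ℝ≥0 × StepPath) × StepPath |
      M.PathAdmissible (M.surplusAt x F z.1) z.2 (G z.1 z.2)} :=
    measurableSet_pathAdmissible ((measurable_surplusAt x F).comp measurable_fst) measurable_snd
      (fun t i => hG.measurable_eval_comp measurable_fst measurable_snd measurable_const i)
      fun _ => (G _).isDividendPath _
  have future_admissible : ∀ᵐ ω ∂P, τ ω ≠ ⊤ → M.PathAdmissible (M.surplusAt x F (M.past τ ω))
      (M.future τ ω) (G (M.past τ ω) (M.future τ ω)) :=
    (ae_restrict_iff' (measurableSet_ne_top hτ)).1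
      ((ae_past_future hτ admissible_measurable).2 (ae_of_all _ fun ω => hadm _))
  rw [← lintegral_pathPayoff_pasted F hτ hG]
  refine lintegral_pathPayoff_le_value hx (isDividendPath_pasted F G) (measurable_pasted F hτ hG) ?_
  filter_upwards [admissibleRule_iff.1 hF, future_admissible, halive] with ω
  exact pathAdmissible_pasted

theorem admissibleRule_zero (x : Fin 2 → ℝ) : M.AdmissibleRule x PathStrategy.zero :=
  ae_of_all _ fun s => .zero x s

theorem AdmissibleRule.mono {y : Fin 2 → ℝ} {F : PathStrategy} (h : M.AdmissibleRule x F)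
    (hxy : x ≤ y) : M.AdmissibleRule y F :=
  Eventually.mono h fun _ hs => hs.mono hxy

theorem AdmissibleRule.isAdmissible {F : PathStrategy} (h : M.AdmissibleRule x F) :
    M.IsAdmissible x fun t ω => F (M.claimPath ω) t :=
  .of_path (fun _ => F.isDividendPath _) (measurable_rule_claimPath F x) (admissibleRule_iff.1 h)

theorem alive_zero_of_claims_eq_zero (hx : x ∈ solvencySet) {p : ℝ≥0 × StepPath}
    (hp : p.2 p.1 = 0) : M.Alive x p.2 (PathStrategy.zero p.2) p.1 := fun r hr => by
  by_contra! hneg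
  refine hx fun i => lt_of_le_of_lt ?_ (hneg i)
  have no_claims : p.2 r = 0 := le_antisymm ((p.2.mono hr).trans_eq hp) (p.2.nonneg r)
  rw [pathSurplus, no_claims, mul_zero, sub_zero]
  exact le_add_of_nonneg_right (mul_nonneg (M.c_pos i).le r.coe_nonneg)

theorem surplusAt_zero_of_claims_eq_zero {p : ℝ≥0 × StepPath} (hp : p.2 p.1 = 0) (i : Fin 2) :
    M.surplusAt x PathStrategy.zero p i = x i + M.c i * p.1 := by
  simp only [surplusAt, pathSurplus, hp, mul_zero, sub_zero, PathStrategy.zero]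

/-- Wait for the premiums of a time span `δ` and follow `F` if no claim has occurred by then. -/
theorem exp_mul_ruleValue_le_value [IsProbabilityMeasure P] {y : Fin 2 → ℝ} {F : PathStrategy}
    {δ : ℝ≥0} (hx : x ∈ solvencySet) (hy : ∀ i, y i ≤ x i + M.c i * δ) (hF : M.AdmissibleRule y F) :
    ENNReal.ofReal (Real.exp (-((M.q + M.rate) * δ))) * M.ruleValue F ≤ M.value x := by
  classical
  let noClaims : Set (ℝ≥0 × StepPath) := {p | p.2 p.1 = 0 ∧ p.1 = δ}
  have noClaims_measurable : MeasurableSet noClaims :=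
    (StepPath.measurable_eval (measurableSet_singleton 0)).inter
      (measurable_fst (measurableSet_singleton δ))
  let G (p : ℝ≥0 × StepPath) : PathStrategy := if p ∈ noClaims then F else .zero
  let τ : Ω → WithTop ℝ≥0 := fun _ => δ
  have waiting_le : M.valueWithReward .zero τ (fun p => M.ruleValue (G p)) ≤ M.value x := by
    refine pasted_le_value hx (isStoppingTime_const _ _) (admissibleRule_zero x)
      (.ite noClaims_measurable (.const F) (.const .zero)) (fun p => ?_) (ae_of_all _ fun ω _ => ?_)
    · by_cases hp : p ∈ noClaims
      · simp only [G, if_pos hp]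
        exact hF.mono fun i =>
          (hy i).trans_eq (hp.2 ▸ (surplusAt_zero_of_claims_eq_zero hp.1 i).symm)
      · simp only [G, if_neg hp]
        exact admissibleRule_zero _
    · by_cases hp : M.past τ ω ∈ noClaims
      · exact .inr (alive_zero_of_claims_eq_zero hx hp.1)
      · exact .inl (if_neg hp)
  have reward_of_noClaims : ∀ ω, M.claims δ ω = 0 → M.ruleValue (G (M.past τ ω)) = M.ruleValue F :=
    fun ω hω => congrArg _ (if_pos ⟨(claimPath_eq_past τ ω δ le_rfl).symm.trans hω, rfl⟩)
  calc ENNReal.ofReal (Real.exp (-((M.q + M.rate) * δ))) * M.ruleValue F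
      = M.discount δ * M.ruleValue F * ENNReal.ofReal (Real.exp (-(M.rate * δ))) := by
        rw [mul_right_comm, discount, ← ENNReal.ofReal_mul (Real.exp_nonneg _), ← Real.exp_add]
        ring_nf
    _ ≤ M.discount δ * M.ruleValue F * P {ω | M.claims δ ω = 0} := by
        gcongr
        exact M.exp_le_measure_claims_eq_zero δ
    _ = ∫⁻ ω in {ω | M.claims δ ω = 0}, M.discount δ * M.ruleValue (G (M.past τ ω)) ∂P := by
        rw [← setLIntegral_const]
        exact setLIntegral_congr_fun (M.measurable_claims δ (measurableSet_singleton 0))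
          fun ω hω => congrArg _ (reward_of_noClaims ω hω).symm
    _ ≤ ∫⁻ ω in {ω | τ ω ≠ ⊤}, M.discount δ * M.ruleValue (G (M.past τ ω)) ∂P :=
        lintegral_mono_set fun _ _ => WithTop.coe_ne_top
    _ ≤ M.value x := le_add_self.trans waiting_le

theorem value_le_mul_value [IsProbabilityMeasure P] {y : Fin 2 → ℝ} {δ : ℝ≥0}
    (hx : x ∈ solvencySet) (hxy : ∀ i, y i ≤ x i + M.c i * δ) :
    M.value y ≤ ENNReal.ofReal (Real.exp ((M.q + M.rate) * δ)) * M.value x := by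
  refine value_le fun F hF => ?_
  have := exp_mul_ruleValue_le_value hx hxy hF
  rw [Real.exp_neg, ENNReal.ofReal_inv_of_pos (Real.exp_pos _)] at this
  exact (ENNReal.inv_mul_le_iff (ENNReal.ofReal_pos.2 (Real.exp_pos _)).ne'
    ENNReal.ofReal_ne_top).1 this

theorem exists_nearly_optimal [IsProbabilityMeasure P] (M : DegenerateRiskModel Ω P)
    (x : Fin 2 → ℝ) {ε : ℝ≥0∞} (hε : ε ≠ 0) :
    ∃ F, M.AdmissibleRule x F ∧ M.value x ≤ M.ruleValue F + ε := by
  by_contra! h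
  have hle : M.value x ≤ M.value x - ε := value_le fun F hF =>
    ENNReal.le_sub_of_add_le_right (ne_top_of_lt (le_add_self.trans_lt (h F hF))) (h F hF).le
  have hne : M.value x ≠ 0 := ne_bot_of_gt (h _ (admissibleRule_zero x))
  exact hle.not_gt (ENNReal.sub_lt_self (M.value_lt_top x).ne hne hε)

/-- The lower left corner of the cell with index `k` of the grid whose cells are as large as the
premiums of a time span `δ`. -/
def gridCorner (M : DegenerateRiskModel Ω P) (δ : ℝ≥0) (k : Fin 2 → ℤ) (i : Fin 2) : ℝ :=
  M.c i * δ * k i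

/-- The index of the grid cell that contains a point. -/
def gridIndex (M : DegenerateRiskModel Ω P) (δ : ℝ≥0) (y : Fin 2 → ℝ) (i : Fin 2) : ℤ :=
  ⌊y i / (M.c i * δ)⌋

theorem measurable_gridIndex (δ : ℝ≥0) : Measurable (M.gridIndex δ) :=
  measurable_pi_lambda _ fun i => ((measurable_pi_apply i).div_const _).floor

section grid

variable {δ : ℝ≥0}

theorem gridCorner_le (hδ : 0 < δ) (y : Fin 2 → ℝ) : M.gridCorner δ (M.gridIndex δ y) ≤ y :=
  fun i => by
  have cell_pos : 0 < M.c i * (δ : ℝ) := mul_pos (M.c_pos i) hδ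
  rw [gridCorner, gridIndex, mul_comm]
  exact (le_div_iff₀ cell_pos).1 (Int.floor_le _)

theorem le_gridCorner_add (hδ : 0 < δ) (y : Fin 2 → ℝ) (i : Fin 2) :
    y i ≤ M.gridCorner δ (M.gridIndex δ y) i + M.c i * δ := by
  have cell_pos : 0 < M.c i * (δ : ℝ) := mul_pos (M.c_pos i) hδ
  rw [gridCorner, gridIndex, ← mul_add_one, mul_comm]
  exact (div_le_iff₀ cell_pos).1 (Int.lt_floor_add_one _).le

theorem gridCorner_mem_solvencySet {y : Fin 2 → ℝ} (hy : y ∈ solvencySet) :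
    M.gridCorner δ (M.gridIndex δ y) ∈ solvencySet := by
  refine fun hneg => hy fun i => ?_
  by_contra! hi
  have hc : 0 ≤ M.c i * (δ : ℝ) := mul_nonneg (M.c_pos i).le δ.coe_nonneg
  refine (hneg i).not_ge (mul_nonneg hc ?_)
  exact_mod_cast Int.floor_nonneg.2 (div_nonneg hi hc)

theorem exists_measurable_nearly_optimal [IsProbabilityMeasure P] (M : DegenerateRiskModel Ω P)
    (hδ : 0 < δ) :
    ∃ G : (Fin 2 → ℝ) → PathStrategy, PathStrategy.IsMeasurableFamily G ∧
      (∀ y, M.AdmissibleRule y (G y)) ∧ ∀ y ∈ solvencySet,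
        M.value y ≤ ENNReal.ofReal (Real.exp ((M.q + M.rate) * δ)) * (M.ruleValue (G y) + δ) := by
  choose opt opt_admissible le_opt using fun y =>
    M.exists_nearly_optimal y (ENNReal.coe_ne_zero.2 hδ.ne')
  refine ⟨fun y => opt (M.gridCorner δ (M.gridIndex δ y)),
    (PathStrategy.IsMeasurableFamily.of_countable fun k => opt (M.gridCorner δ k)).comp
      (measurable_gridIndex δ),
    fun y => (opt_admissible _).mono (gridCorner_le hδ y), fun y hy => ?_⟩
  refine (value_le_mul_value (gridCorner_mem_solvencySet hy) (le_gridCorner_add hδ y)).trans ?_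
  gcongr
  exact le_opt _

end grid

theorem exists_measurableSet_mem_iff_alive (M : DegenerateRiskModel Ω P) (x : Fin 2 → ℝ)
    (F : PathStrategy) :
    ∃ A : Set (ℝ≥0 × StepPath), MeasurableSet A ∧ ∀ p s, (∀ u ≤ p.1, s u = p.2 u) →
      M.PathAdmissible x s (F s) → (p ∈ A ↔ M.Alive x p.2 (F p.2) p.1) := by
  refine ⟨{p | (∃ i, F p.2 p.1 i ≤ M.pathSurplus x p.2 p.1 i) ∧ ∀ n, denseTime n < p.1 →
    ∃ i, F p.2 (denseTime n) i ≤ M.pathSurplus x p.2 (denseTime n) i}, ?_, fun p s h hs => ?_⟩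
  · simp only [ofPred_and, ofPred_forall, ofPred_exists]
    refine .inter (.iUnion fun i => measurableSet_le (F.measurable_eval i)
      (measurable_pathSurplus measurable_const measurable_snd measurable_fst i))
      (.iInter fun n => .imp (measurableSet_lt measurable_const measurable_fst) ?_)
    simp only [ofPred_exists]
    exact .iUnion fun i => measurableSet_le ((F.measurable_apply _ i).comp measurable_snd)
      (measurable_pathSurplus measurable_const measurable_snd measurable_const i)
  · rw [← alive_congr F h, hs.alive_iff_denseTime]
    simp only [mem_ofPred_eq]
    rw [F.eq_of_le h le_rfl]
    simp only [pathSurplus_congr (h p.1 le_rfl)]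
    refine and_congr_right fun _ => forall₂_congr fun n hn => ?_
    simp only [F.eq_of_le h hn.le, pathSurplus_congr (h _ hn.le)]

theorem AdmissibleRule.valueWithReward_le_mul [IsProbabilityMeasure P] {F : PathStrategy}
    (hx : x ∈ solvencySet) (hτ : IsStoppingTime (M.filtration x) τ) (hF : M.AdmissibleRule x F)
    {δ : ℝ≥0} (hδ : 0 < δ) :
    M.valueWithReward F τ (M.valueAt x F) ≤
      ENNReal.ofReal (Real.exp ((M.q + M.rate) * δ)) * (M.value x + δ) := by
  classical
  obtain ⟨opt, opt_measurable, opt_admissible, value_le_opt⟩ :=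
    M.exists_measurable_nearly_optimal hδ
  obtain ⟨A, hA, mem_iff_alive⟩ := M.exists_measurableSet_mem_iff_alive x F
  have past_mem_iff : ∀ᵐ ω ∂P, M.past τ ω ∈ A ↔
      M.Alive x (M.past τ ω).2 (F (M.past τ ω).2) (M.past τ ω).1 :=
    (admissibleRule_iff.1 hF).mono fun ω => mem_iff_alive _ _ (claimPath_eq_past τ ω)
  set E : ℝ≥0∞ := ENNReal.ofReal (Real.exp ((M.q + M.rate) * δ))
  have one_le_E : 1 ≤ E := ENNReal.one_le_ofReal.2
    (Real.one_le_exp (mul_nonneg (add_nonneg M.q_pos.le M.rate.coe_nonneg) δ.coe_nonneg))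
  let G (p : ℝ≥0 × StepPath) : PathStrategy := if p ∈ A then opt (M.surplusAt x F p) else .zero
  have pasted_opt_le : M.valueWithReward F τ (fun p => M.ruleValue (G p)) ≤ M.value x := by
    refine pasted_le_value hx hτ hF (.ite hA (opt_measurable.comp (measurable_surplusAt x F))
      (.const .zero)) (fun p => ?_) (past_mem_iff.mono fun ω hω _ => ?_)
    · by_cases hp : p ∈ A
      · simpa only [G, if_pos hp] using opt_admissible _
      · simpa only [G, if_neg hp] using admissibleRule_zero _
    · by_cases hp : M.past τ ω ∈ A
      · exact .inr (hω.1 hp)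
      · exact .inl (if_neg hp)
  calc M.valueWithReward F τ (M.valueAt x F)
      ≤ M.valueWithReward F τ fun p => E * (M.ruleValue (G p) + δ) := by
        refine valueWithReward_mono_ae (ae_restrict_of_ae (past_mem_iff.mono fun ω hω => ?_))
        by_cases halive : M.Alive x (M.past τ ω).2 (F (M.past τ ω).2) (M.past τ ω).1
        · simp only [valueAt_of_alive halive, G, if_pos (hω.2 halive)]
          exact value_le_opt _ (surplusAt_mem_solvencySet halive)
        · exact (valueAt_of_not_alive halive).trans_le zero_le
    _ ≤ E * (M.valueWithReward F τ (fun p => M.ruleValue (G p)) + δ) :=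
        valueWithReward_mul_add_le F τ _ one_le_E ENNReal.ofReal_ne_top
    _ ≤ E * (M.value x + δ) := by gcongr

theorem le_of_forall_le_exp_mul_add {a b : ℝ≥0∞} {r : ℝ}
    (h : ∀ δ : ℝ≥0, 0 < δ → a ≤ ENNReal.ofReal (Real.exp (r * δ)) * (b + δ)) : a ≤ b := by
  have factor_continuous : Continuous fun δ : ℝ≥0 => ENNReal.ofReal (Real.exp (r * δ)) :=
    ENNReal.continuous_ofReal.comp (by fun_prop)
  have term_continuous : Continuous fun δ : ℝ≥0 => b + (δ : ℝ≥0∞) := by fun_prop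
  have limit := ENNReal.Tendsto.mul (factor_continuous.tendsto 0)
    (.inl (ENNReal.ofReal_pos.2 (Real.exp_pos _)).ne') (term_continuous.tendsto 0)
    (.inr ENNReal.ofReal_ne_top)
  simpa using ge_of_tendsto (limit.mono_left (nhdsWithin_le_nhds (s := Ioi 0)))
    (eventually_mem_nhdsWithin.mono h)

theorem AdmissibleRule.valueWithReward_le_value [IsProbabilityMeasure P] {F : PathStrategy}
    (hF : M.AdmissibleRule x F) (hx : x ∈ solvencySet) (hτ : IsStoppingTime (M.filtration x) τ) :
    M.valueWithReward F τ (M.valueAt x F) ≤ M.value x :=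
  le_of_forall_le_exp_mul_add fun _ => hF.valueWithReward_le_mul hx hτ

end DegenerateRiskModel

end

theorem mainTheorem6 {Ω : Type*} [MeasurableSpace Ω] (P : Measure Ω) [IsProbabilityMeasure P]
    (M : DegenerateRiskModel Ω P) (x : Fin 2 → ℝ) (hx : x ∈ solvencySet)
    (τ : Ω → WithTop ℝ≥0) (hτ : IsStoppingTime (M.filtration x) τ) :
    M.value x ≠ ⊤ ∧
    M.value x = ⨆ (L) (_ : M.IsAdmissible x L),
      ∫⁻ ω, (M.dividends L (min (τ ω) (M.ruinTime x L ω)) ω +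
        M.discountedValue x L (min (τ ω) (M.ruinTime x L ω)) ω) ∂P := by
  refine ⟨(M.value_lt_top x).ne, le_antisymm
    (DegenerateRiskModel.value_le fun F hF => ?_) (iSup₂_le fun L hL => ?_)⟩
  · refine le_iSup₂_of_le _ hF.isAdmissible ?_
    rw [DegenerateRiskModel.lintegral_dividends_add_discountedValue hx hτ hF
      (ae_of_all _ fun _ => rfl)]
    exact hF.ruleValue_le_valueWithReward hτ
  · obtain ⟨F, hF, eq_rule⟩ := hL.exists_rule hx
    rw [DegenerateRiskModel.lintegral_dividends_add_discountedValue hx hτ hF eq_rule]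
    exact hF.valueWithReward_le_value hx hτ
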